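/- Theorem. A unimodular lattice in $\mathbb{R}^n$ is a full-rank discrete subgroup $\Lambda\subset\mathbb{R}^n$ with $(x,y)\in\mathbb{Z}$ for all $x,y\in\Lambda$ and determinant (covolume) $1$. The norm of a vector $x$ is $\|x\|^2=(x,x)$. Put $\Theta_\Lambda(z)=\sum_{x\in\Lambda}e^{\pi i\|x\|^2z}$ for $\operatorname{Im} z>0$, and let $\Xi_\Lambda(y)=\Theta_{\mathbb{Z}^n}(yi)/\Theta_\Lambda(yi)$, $y>0$, be the secrecy function of $\Lambda$. The Belfiore–Solé conjecture asserts that for every $n$ and every unimodular lattice $\Lambda\subset\mathbb{R}^n$ the function $\Xi_\Lambda$ attains its maximum over $y>0$ at $y=1$. A vector $w\in\Lambda$ is characteristic if $(w,v)\equiv(v,v)\pmod 2$ for all $v\in\Lambda$. An $n-24$ lattice is a unimodular lattice $\Lambda\subset\mathbb{R}^n$ all of whose characteristic vectors have norm at least $n-24$. If the Belfiore–Solé conjecture holds, then for every integer $n$ with $23171\le n\le 8388630$ there is no $n-24$ lattice in $\mathbb{R}^n$ without roots, i.e. without vectors of norm $1$ or $2$. -/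

import Mathlib

noncomputable section

/-- `Λ` is a unimodular lattice in `ℝⁿ`: a full-rank discrete subgroup, all of whose inner products
are integers (so all norms `‖x‖²` are integers), with a fundamental domain of volume `1`, i.e. with
Gram determinant `1`. -/
structure IsUnimodularLattice {n : ℕ} (Λ : Submodule ℤ (EuclideanSpace ℝ (Fin n))) : Prop where
  discrete : DiscreteTopology Λ
  isZLattice : IsZLattice ℝ Λ
  integral : ∀ x ∈ Λ, ∀ y ∈ Λ, ∃ m : ℤ, inner ℝ x y = (m : ℝ)
  covolume_eq_one : ZLattice.covolume Λ = 1

/-- The standard lattice `ℤⁿ` in `ℝⁿ`. -/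
def standardLattice (n : ℕ) : Submodule ℤ (EuclideanSpace ℝ (Fin n)) :=
  Submodule.span ℤ (Set.range (EuclideanSpace.basisFun (Fin n) ℝ).toBasis)

/-- The theta function `Θ_Λ(z) = ∑_{x ∈ Λ} exp(π i ‖x‖² z)`, for `z` in the upper half plane. -/
def latticeTheta {n : ℕ} (Λ : Submodule ℤ (EuclideanSpace ℝ (Fin n))) (z : ℂ) : ℂ :=
  ∑' x : Λ, Complex.exp (Real.pi * Complex.I * ((‖(x : EuclideanSpace ℝ (Fin n))‖ ^ 2 : ℝ) : ℂ) * z)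

/-- On the imaginary axis the theta function is real. -/
theorem latticeTheta_mul_I {n : ℕ} (Λ : Submodule ℤ (EuclideanSpace ℝ (Fin n))) (y : ℝ) :
    latticeTheta Λ (y * Complex.I) =
      ((∑' x : Λ, Real.exp (-Real.pi * ‖(x : EuclideanSpace ℝ (Fin n))‖ ^ 2 * y) : ℝ) : ℂ) := by
  rw [latticeTheta, Complex.ofReal_tsum]
  refine tsum_congr fun x => ?_
  rw [Complex.ofReal_exp]
  congr 1
  push_cast
  linear_combination
    (Real.pi * (‖(x : EuclideanSpace ℝ (Fin n))‖ : ℂ) ^ 2 * y) * Complex.I_mul_I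

/-- The secrecy function `Ξ_Λ(y) = Θ_{ℤⁿ}(yi) / Θ_Λ(yi)`, for `y > 0`. The quotient is a real
number because both theta functions are real on the imaginary axis. -/
def secrecyFunction {n : ℕ} (Λ : Submodule ℤ (EuclideanSpace ℝ (Fin n))) (y : ℝ) : ℝ :=
  (latticeTheta (standardLattice n) (y * Complex.I) / latticeTheta Λ (y * Complex.I)).re

/-- The Belfiore–Solé conjecture: in every dimension, the secrecy function of every unimodular
lattice attains its maximum over `y > 0` at `y = 1`. -/
def BelfioreSoleConjecture : Prop :=
  ∀ (n : ℕ) (Λ : Submodule ℤ (EuclideanSpace ℝ (Fin n))), IsUnimodularLattice Λ →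
    IsMaxOn (secrecyFunction Λ) (Set.Ioi 0) 1

/-- `w ∈ Λ` is a characteristic vector of `Λ`: `(w, v) ≡ (v, v) (mod 2)` for all `v ∈ Λ`. -/
def IsCharacteristicVector {n : ℕ} (Λ : Submodule ℤ (EuclideanSpace ℝ (Fin n)))
    (w : EuclideanSpace ℝ (Fin n)) : Prop :=
  w ∈ Λ ∧ ∀ v ∈ Λ, ∃ m : ℤ, inner ℝ w v - inner ℝ v v = 2 * (m : ℝ)

/-- `Λ` is an `n - 8k` lattice: a unimodular lattice in `ℝⁿ` all of whose characteristic vectors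
have norm `‖w‖²` at least `n - 8k` (a real, not truncated, difference). -/
def IsNSubEightMulLattice {n : ℕ} (k : ℕ) (Λ : Submodule ℤ (EuclideanSpace ℝ (Fin n))) : Prop :=
  IsUnimodularLattice Λ ∧ ∀ w, IsCharacteristicVector Λ w → (n : ℝ) - 8 * (k : ℝ) ≤ ‖w‖ ^ 2

/-- `Λ` has no roots, i.e. no vectors of norm `‖v‖² = 1` or `‖v‖² = 2`. -/
def HasNoRoots {n : ℕ} (Λ : Submodule ℤ (EuclideanSpace ℝ (Fin n))) : Prop :=
  ∀ v ∈ Λ, ‖v‖ ^ 2 ≠ 1 ∧ ‖v‖ ^ 2 ≠ 2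

end

/-! Write n = m + 24 and q = exp(πiτ), and fix a characteristic vector w. The shadow series, that is
the theta series of Λ + w/2, is obtained from Θ_Λ by a translation by 1 and an inversion. Norms of
characteristic vectors are congruent to n modulo 8, so for an n - 24 lattice the shadow series is
q^(m/4) (N₀ + N₂ q² + ⋯), where N₀ and N₂ count the characteristic vectors of norm n - 24 and n -
16.

Then Θ_Λ is a combination of θ₃ⁿ⁻⁸ʳ(θ₂θ₄)⁴ʳ with r ≤ 3. Without roots Θ_Λ = 1 + O(q³), which fixes
the coefficients for r ≤ 2; the one for r = 3 is proportional to N₀. Reading the same combination on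
the shadow side gives N₂ = 2^(m+1) (m + 24)(m + 1) + (m - 48) N₀ (`ncard_shadowExponent_eq_two`),
hence N₂ ≥ 2^(m+1) n(n - 23) when m ≥ 48. Conversely, two characteristic vectors of norm n - 16
congruent modulo 4Λ differ by 4v with ‖v‖² ≤ 2, so v = 0 and N₂ ≤ 2^n
(`ncard_shadowExponent_eq_two_le`). Thus n(n - 23) ≤ 2^23, which is false for n ≥ 23171.

The decomposition does not need the ring of modular forms of the theta group. The coefficients are
chosen so that the difference F of the two sides is O(q⁴). The product of F, its translate by 1 and
its shadow has an eighth power of level one and weight 12n, vanishing at infinity to order m + 32 >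
n, so it is zero (`IsThetaTriple.shadow_eq_zero`). The transformation laws rest on Poisson summation
(`tsum_translate_inversion`). -/

open MeasureTheory

/-! ### Poisson summation over ℤ^ι. -/

/-- The character `t ↦ exp (2πi ∑ kᵢ tᵢ)` evaluated on the torus. -/
theorem mFourier_coe_apply {ι : Type*} [Fintype ι] (k : ι → ℤ) (t : ι → ℝ) :
    UnitAddTorus.mFourier k (fun i => (t i : UnitAddCircle)) =
      Complex.exp (2 * Real.pi * Complex.I * ∑ i, (k i : ℂ) * (t i : ℂ)) := by
  simp only [UnitAddTorus.mFourier, ContinuousMap.coe_mk, fourier_coe_apply, ← Complex.exp_sum,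
    Finset.mul_sum]
  congr 1
  refine Finset.sum_congr rfl fun i _ => ?_
  push_cast
  ring

/-- The supremum of a translate over all `t` does not depend on `m`, so a summable bound is only
asked for on balls; continuity being local, that is enough. -/
theorem continuous_tsum_translates {ι : Type*} [Fintype ι] {f : (ι → ℝ) → ℂ} (hf : Continuous f)
    (hu : ∀ R : ℝ, ∃ u : (ι → ℤ) → ℝ, Summable u ∧
      ∀ t : ι → ℝ, ‖t‖ ≤ R → ∀ m, ‖f (t + fun i => (m i : ℝ))‖ ≤ u m) :
    Continuous fun t : ι → ℝ => ∑' m : ι → ℤ, f (t + fun i => (m i : ℝ)) := by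
  rw [continuous_iff_continuousAt]
  intro t₀
  obtain ⟨u, hu, hb⟩ := hu (‖t₀‖ + 1)
  have hc : ContinuousOn (fun t : ι → ℝ => ∑' m : ι → ℤ, f (t + fun i => (m i : ℝ)))
      (Metric.closedBall 0 (‖t₀‖ + 1)) :=
    continuousOn_tsum (fun m => (hf.comp (by fun_prop)).continuousOn) hu
      fun m t ht => hb t (by simpa using ht) m
  refine hc.continuousAt (Filter.mem_of_superset (Metric.ball_mem_nhds t₀ one_pos) fun t ht => ?_)
  rw [mem_closedBall_zero_iff]
  rw [mem_ball_iff_norm] at ht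
  have := norm_add_le t₀ (t - t₀)
  rw [add_sub_cancel] at this
  linarith

/-- A continuous `ℤ^ι`-periodic function descends to the torus. -/
theorem exists_continuousMap_unitAddTorus {ι : Type*} [Fintype ι] {F : (ι → ℝ) → ℂ}
    (hF : Continuous F) (hper : ∀ (t : ι → ℝ) (m : ι → ℤ), F (t + fun i => (m i : ℝ)) = F t) :
    ∃ G : C(UnitAddTorus ι, ℂ), ∀ t : ι → ℝ, G (fun i => (t i : UnitAddCircle)) = F t := by
  let p : C(ι → ℝ, UnitAddTorus ι) :=
    ⟨Pi.map (fun (_ : ι) (x : ℝ) => (x : UnitAddCircle)),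
      (IsOpenQuotientMap.piMap fun _ => QuotientAddGroup.isOpenQuotientMap_mk).continuous⟩
  have hq : Topology.IsQuotientMap p :=
    (IsOpenQuotientMap.piMap fun _ => QuotientAddGroup.isOpenQuotientMap_mk).isQuotientMap
  have hlift : Function.FactorsThrough F p := by
    intro s t h
    have h' : ∀ i, ∃ k : ℤ, s i = t i + k := by
      intro i
      have hi : (s i : UnitAddCircle) = t i := congrFun h i
      rw [← sub_eq_zero, ← AddCircle.coe_sub, AddCircle.coe_eq_zero_iff] at hi
      obtain ⟨k, hk⟩ := hi
      exact ⟨k, by simp at hk; linarith⟩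
    choose m hm using h'
    rw [show s = t + fun i => (m i : ℝ) from funext hm, hper]
  refine ⟨hq.lift ⟨F, hF⟩ hlift, fun t => ?_⟩
  exact congrArg (fun g => g t) (hq.lift_comp ⟨F, hF⟩ hlift)

/-- The `Ioc` cube is the one used for Fourier coefficients on the torus; it agrees with the
fundamental domain of ℤ^ι up to a null set. -/
theorem integral_eq_tsum_integral_unit_cube {ι : Type*} [Fintype ι] {f : (ι → ℝ) → ℂ}
    (hf : Integrable f) :
    ∫ t, f t = ∑' m : ι → ℤ, ∫ t in {t : ι → ℝ | ∀ i, t i ∈ Set.Ioc (0 : ℝ) (0 + 1)},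
      f (t + fun i => (m i : ℝ)) := by
  have hdom := ZSpan.isAddFundamentalDomain' (Pi.basisFun ℝ ι) volume
  have hset : ZSpan.fundamentalDomain (Pi.basisFun ℝ ι) =ᵐ[volume]
      {t : ι → ℝ | ∀ i, t i ∈ Set.Ioc (0 : ℝ) (0 + 1)} := by
    rw [ZSpan.fundamentalDomain_pi_basisFun]
    have h1 := Measure.univ_pi_Ico_ae_eq_Icc (μ := fun _ : ι => (volume : Measure ℝ))
      (f := fun _ => 0) (g := fun _ => 1)
    have h2 := Measure.univ_pi_Ioc_ae_eq_Icc (μ := fun _ : ι => (volume : Measure ℝ))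
      (f := fun _ => 0) (g := fun _ => 1)
    rw [show {t : ι → ℝ | ∀ i, t i ∈ Set.Ioc (0 : ℝ) (0 + 1)} =
      Set.univ.pi fun _ => Set.Ioc (0 : ℝ) 1 by ext; simp]
    exact h1.trans h2.symm
  have : Countable (Submodule.span ℤ (Set.range (Pi.basisFun ℝ ι))).toAddSubgroup :=
    inferInstanceAs (Countable (Submodule.span ℤ (Set.range (Pi.basisFun ℝ ι))))
  rw [hdom.integral_eq_tsum'' f hf,
    ← (show (ι → ℤ) ≃ (Submodule.span ℤ (Set.range (Pi.basisFun ℝ ι))).toAddSubgroup from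
      ((Pi.basisFun ℝ ι).restrictScalars ℤ).equivFun.symm.toEquiv).tsum_eq]
  refine tsum_congr fun m => ?_
  rw [setIntegral_congr_set hset]
  refine integral_congr_ae (Filter.Eventually.of_forall fun t => ?_)
  simp only [AddSubgroup.vadd_def, vadd_eq_add]
  rw [add_comm]
  congr 2
  change (((((Pi.basisFun ℝ ι).restrictScalars ℤ).equivFun.symm m :
    Submodule.span ℤ (Set.range (Pi.basisFun ℝ ι)))) : ι → ℝ) = _
  ext i
  classical
  simp [Module.Basis.equivFun_symm_apply, Pi.basisFun_apply, Pi.single_apply]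

/-- Poisson summation over `ℤ^ι`. -/
theorem tsum_int_eq_tsum_integral_exp {ι : Type*} [Fintype ι] {f : (ι → ℝ) → ℂ}
    (hf : Continuous f) (hint : Integrable f)
    (hu : ∀ R : ℝ, ∃ u : (ι → ℤ) → ℝ, Summable u ∧
      ∀ t : ι → ℝ, ‖t‖ ≤ R → ∀ m, ‖f (t + fun i => (m i : ℝ))‖ ≤ u m)
    (hc : Summable fun k : ι → ℤ =>
      ∫ t : ι → ℝ, Complex.exp (-(2 * Real.pi * Complex.I * ∑ i, (k i : ℂ) * (t i : ℂ))) * f t) :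
    ∑' m : ι → ℤ, f (fun i => (m i : ℝ)) = ∑' k : ι → ℤ,
      ∫ t : ι → ℝ, Complex.exp (-(2 * Real.pi * Complex.I * ∑ i, (k i : ℂ) * (t i : ℂ))) * f t := by
  set F : (ι → ℝ) → ℂ := fun t => ∑' m : ι → ℤ, f (t + fun i => (m i : ℝ)) with hFdef
  have hFc : Continuous F := continuous_tsum_translates hf hu
  have hper : ∀ (t : ι → ℝ) (m : ι → ℤ), F (t + fun i => (m i : ℝ)) = F t := by
    intro t m
    simp only [hFdef]
    rw [← (Equiv.addLeft m).tsum_eq fun m' => f (t + fun i => (m' i : ℝ))]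
    refine tsum_congr fun m' => ?_
    congr 1
    ext i
    simp [add_assoc]
  obtain ⟨G, hG⟩ := exists_continuousMap_unitAddTorus hFc hper
  have hexp : ∀ (k : ι → ℤ) (t : ι → ℝ),
      ‖Complex.exp (-(2 * Real.pi * Complex.I * ∑ i, (k i : ℂ) * (t i : ℂ)))‖ = 1 := by
    intro k t
    rw [show -(2 * Real.pi * Complex.I * ∑ i, (k i : ℂ) * (t i : ℂ)) =
      ((-(2 * Real.pi * ∑ i, (k i : ℝ) * t i) : ℝ) : ℂ) * Complex.I by push_cast; ring,
      Complex.norm_exp_ofReal_mul_I]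
  have hcoef : ∀ k : ι → ℤ, UnitAddTorus.mFourierCoeff G k =
      ∫ t : ι → ℝ, Complex.exp (-(2 * Real.pi * Complex.I * ∑ i, (k i : ℂ) * (t i : ℂ))) * f t := by
    intro k
    rw [UnitAddTorus.mFourierCoeff_eq_integral G k 0]
    have hgi : Integrable fun t : ι → ℝ =>
        Complex.exp (-(2 * Real.pi * Complex.I * ∑ i, (k i : ℂ) * (t i : ℂ))) * f t := by
      refine hint.mono ?_ (Filter.Eventually.of_forall fun t => ?_)
      · exact (Continuous.mul (by fun_prop) hf).aestronglyMeasurable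
      · rw [norm_mul, hexp, one_mul]
    rw [integral_eq_tsum_integral_unit_cube hgi]
    simp only [Pi.zero_apply]
    obtain ⟨u, hus, hub⟩ := hu 1
    have hbox : {t : ι → ℝ | ∀ i, t i ∈ Set.Ioc (0 : ℝ) (0 + 1)} =
      Set.univ.pi fun _ => Set.Ioc (0 : ℝ) (0 + 1) := by ext; simp
    have hmeas : MeasurableSet {t : ι → ℝ | ∀ i, t i ∈ Set.Ioc (0 : ℝ) (0 + 1)} := by
      rw [hbox]
      exact MeasurableSet.univ_pi fun _ => measurableSet_Ioc
    have hvol : volume {t : ι → ℝ | ∀ i, t i ∈ Set.Ioc (0 : ℝ) (0 + 1)} = 1 := by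
      rw [hbox, Real.volume_pi_Ioc]
      simp
    have hnorm : ∀ t ∈ {t : ι → ℝ | ∀ i, t i ∈ Set.Ioc (0 : ℝ) (0 + 1)}, ‖t‖ ≤ 1 := by
      intro t ht
      rw [pi_norm_le_iff_of_nonneg zero_le_one]
      intro i
      rw [Real.norm_eq_abs, abs_le]
      have := ht i
      rw [Set.mem_Ioc] at this
      constructor <;> linarith
    have hle : ∀ m : ι → ℤ, ∀ t ∈ {t : ι → ℝ | ∀ i, t i ∈ Set.Ioc (0 : ℝ) (0 + 1)},
        ‖Complex.exp (-(2 * Real.pi * Complex.I * ∑ i, (k i : ℂ) *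
          (((t + fun i => (m i : ℝ)) i : ℝ) : ℂ))) * f (t + fun i => (m i : ℝ))‖ ≤ u m := by
      intro m t ht
      rw [norm_mul, hexp, one_mul]
      exact hub t (hnorm t ht) m
    -- Sum and integral are interchanged: the cube has volume 1, so the `m`-th integral of norms is
    -- at most `u m`.
    have hsum := hasSum_integral_of_summable_integral_norm
      (μ := volume.restrict {t : ι → ℝ | ∀ i, t i ∈ Set.Ioc (0 : ℝ) (0 + 1)})
      (F := fun (m : ι → ℤ) t => Complex.exp (-(2 * Real.pi * Complex.I * ∑ i, (k i : ℂ) *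
          (((t + fun i => (m i : ℝ)) i : ℝ) : ℂ))) * f (t + fun i => (m i : ℝ)))
      (fun m => (hgi.comp_add_right (fun i => (m i : ℝ))).integrableOn)
      (Summable.of_nonneg_of_le (fun m => integral_nonneg fun t => norm_nonneg _)
        (fun m => by
          refine (Real.le_norm_self _).trans ((norm_setIntegral_le_of_norm_le_const
            (C := u m) (by rw [hvol]; simp) fun t ht => ?_).trans ?_)
          · rw [norm_norm]
            exact hle m t ht
          · rw [Measure.real, hvol]
            simp) hus)
    rw [hsum.tsum_eq]
    refine setIntegral_congr_fun hmeas fun t _ => ?_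
    simp only [hG, smul_eq_mul]
    rw [mFourier_coe_apply, hFdef, ← tsum_mul_left]
    refine tsum_congr fun m => ?_
    congr 1
    rw [Complex.exp_eq_exp_iff_exists_int]
    refine ⟨∑ i, k i * m i, ?_⟩
    push_cast
    simp only [Pi.neg_apply, Pi.add_apply, Finset.mul_sum, Finset.sum_mul,
      ← Finset.sum_neg_distrib, ← Finset.sum_add_distrib]
    refine Finset.sum_congr rfl fun i _ => ?_
    push_cast
    ring
  have hs : Summable (UnitAddTorus.mFourierCoeff G) := by
    rw [show UnitAddTorus.mFourierCoeff G = _ from funext hcoef]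
    exact hc
  have h := UnitAddTorus.hasSum_mFourier_series_apply_of_summable hs
    (fun i => (((0 : ι → ℝ) i : ℝ) : UnitAddCircle))
  rw [hG] at h
  have h0 : F 0 = ∑' m : ι → ℤ, f (fun i => (m i : ℝ)) := by simp [hFdef]
  rw [← h0, ← h.tsum_eq]
  refine tsum_congr fun k => ?_
  rw [hcoef, mFourier_coe_apply]
  simp

/-! ### Self-duality, characteristic vectors and convergence. -/

namespace IsUnimodularLattice

variable {n : ℕ} {Λ : Submodule ℤ (EuclideanSpace ℝ (Fin n))}

theorem nonempty_basis (h : IsUnimodularLattice Λ) : Nonempty (Module.Basis (Fin n) ℤ Λ) := by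
  have := h.discrete
  have := h.isZLattice
  have := ZLattice.module_free ℝ Λ
  have := ZLattice.module_finite ℝ Λ
  have hr : Module.finrank ℤ Λ = n := by rw [ZLattice.rank ℝ Λ, finrank_euclideanSpace_fin]
  exact ⟨(Module.finBasis ℤ Λ).reindex (finCongr hr)⟩

theorem addHaar_ofZLatticeBasis (h : IsUnimodularLattice Λ) [DiscreteTopology Λ] [IsZLattice ℝ Λ]
    (b : Module.Basis (Fin n) ℤ Λ) : (b.ofZLatticeBasis ℝ Λ).addHaar = volume := by
  rw [Module.Basis.addHaar_eq_iff, Module.Basis.coe_parallelepiped,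
    ← measure_congr (ZSpan.fundamentalDomain_ae_parallelepiped _ _)]
  have h1 := ZLattice.covolume_eq_measure_fundamentalDomain Λ volume
    (ZLattice.isAddFundamentalDomain b volume)
  rw [h.covolume_eq_one] at h1
  rw [← ENNReal.toReal_eq_one_iff]
  exact h1.symm

theorem abs_det_eq_one (h : IsUnimodularLattice Λ) (b : Module.Basis (Fin n) ℤ Λ) :
    |(Matrix.of fun i j => (b i : EuclideanSpace ℝ (Fin n)) j).det| = 1 := by
  have := h.discrete
  have := h.isZLattice
  have h1 := ZLattice.covolume_eq_det_mul_measureReal Λ volume b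
    (EuclideanSpace.basisFun (Fin n) ℝ).toBasis
  rw [h.covolume_eq_one, measureReal_congr (ZSpan.fundamentalDomain_ae_parallelepiped _ _),
    Measure.real, OrthonormalBasis.coe_toBasis, OrthonormalBasis.volume_parallelepiped,
    ENNReal.toReal_one, mul_one, Module.Basis.det_apply] at h1
  rw [h1, ← Matrix.det_transpose]
  rfl

/-- A unimodular lattice is self-dual. -/
theorem exists_inner_basis_eq (h : IsUnimodularLattice Λ) (b : Module.Basis (Fin n) ℤ Λ)
    (m : Fin n → ℤ) : ∃ x : Λ, ∀ i,
      inner ℝ (x : EuclideanSpace ℝ (Fin n)) (b i : EuclideanSpace ℝ (Fin n)) = m i := by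
  choose G hG using fun i j => h.integral (b i) (b i).2 (b j) (b j).2
  set M : Matrix (Fin n) (Fin n) ℝ := Matrix.of fun i j => (b i : EuclideanSpace ℝ (Fin n)) j
  have hGM : (Matrix.of G).map (Int.castRingHom ℝ) = M * M.transpose := by
    ext i j
    rw [Matrix.map_apply, Matrix.of_apply, eq_intCast, ← hG, Matrix.mul_apply]
    simp [M, PiLp.inner_apply, mul_comm]
  -- The Gram determinant is the square of ±1, so the Gram matrix is invertible over ℤ.
  have hdet : (Matrix.of G).det = 1 := by
    have h2 : (((Matrix.of G).det : ℤ) : ℝ) = 1 := by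
      rw [← eq_intCast (Int.castRingHom ℝ), RingHom.map_det, RingHom.mapMatrix_apply, hGM,
        Matrix.det_mul, Matrix.det_transpose, ← sq, ← sq_abs, h.abs_det_eq_one b, one_pow]
    exact_mod_cast h2
  have hu : IsUnit (Matrix.of G).det := by rw [hdet]; exact isUnit_one
  set c := Matrix.vecMul m (Matrix.of G)⁻¹
  have hc : Matrix.vecMul c (Matrix.of G) = m := by
    rw [Matrix.vecMul_vecMul, Matrix.nonsing_inv_mul _ hu, Matrix.vecMul_one]
  refine ⟨∑ j, c j • b j, fun i => ?_⟩
  rw [← hc, Submodule.coe_sum, sum_inner, Matrix.vecMul, dotProduct, Int.cast_sum]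
  refine Finset.sum_congr rfl fun j _ => ?_
  rw [Submodule.coe_smul, ← Int.cast_smul_eq_zsmul ℝ, real_inner_smul_left, hG]
  simp

/-- Modulo 2 the map v ↦ (v, v) is additive, so self-duality represents it by an inner product;
matching it on a basis is enough. -/
theorem exists_isCharacteristicVector (h : IsUnimodularLattice Λ) :
    ∃ w, IsCharacteristicVector Λ w := by
  have := h.discrete
  have := h.isZLattice
  obtain ⟨b⟩ := h.nonempty_basis
  choose m hm using fun i => h.integral (b i) (b i).2 (b i) (b i).2
  obtain ⟨w, hw⟩ := h.exists_inner_basis_eq b m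
  refine ⟨w, w.2, fun v hv => ?_⟩
  rw [← b.ofZLatticeBasis_span ℝ] at hv
  have hv' : ∀ x ∈ Submodule.span ℤ (Set.range (b.ofZLatticeBasis ℝ Λ)), x ∈ Λ := fun x hx => by
    rwa [b.ofZLatticeBasis_span ℝ] at hx
  induction hv using Submodule.span_induction with
  | mem x hx =>
    obtain ⟨i, rfl⟩ := hx
    exact ⟨0, by rw [b.ofZLatticeBasis_apply ℝ, hw, hm]; simp⟩
  | zero => exact ⟨0, by simp⟩
  | add x y hx hy ihx ihy =>
    obtain ⟨k, hk⟩ := ihx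
    obtain ⟨l, hl⟩ := ihy
    obtain ⟨p, hp⟩ := h.integral x (hv' x hx) y (hv' y hy)
    refine ⟨k + l - p, ?_⟩
    rw [inner_add_right, real_inner_add_add_self, hp]
    push_cast
    linarith
  | smul a x hx ih =>
    obtain ⟨k, hk⟩ := ih
    obtain ⟨p, hp⟩ := h.integral x (hv' x hx) x (hv' x hx)
    obtain ⟨e, he⟩ := Int.even_mul_succ_self (a - 1)
    refine ⟨a * k - e * p, ?_⟩
    have he' : ((a : ℝ) - 1) * a = 2 * e := by
      have : (((a - 1) * (a - 1 + 1) : ℤ) : ℝ) = ((e + e : ℤ) : ℝ) := by rw [he]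
      push_cast at this
      linarith
    rw [← Int.cast_smul_eq_zsmul ℝ, real_inner_smul_right, real_inner_smul_left,
      real_inner_smul_right, hp]
    rw [hp] at hk
    push_cast
    linear_combination (a : ℝ) * hk - p * he'

/-- The bound exp(-t) ≤ d!/t^d at t = c‖x‖² compares with ‖x‖^(-2d), and 2d exceeds the rank. -/
theorem summable_exp_neg_mul_norm_sq (h : IsUnimodularLattice Λ) {c : ℝ} (hc : 0 < c) :
    Summable fun x : Λ => Real.exp (-c * ‖(x : EuclideanSpace ℝ (Fin n))‖ ^ 2) := by
  have := h.discrete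
  have hs := ZLattice.summable_norm_rpow Λ (-(2 * (Module.finrank ℤ Λ + 1 : ℕ) : ℝ))
    (by push_cast; linarith [(Nat.cast_nonneg (Module.finrank ℤ Λ) : (0 : ℝ) ≤ _)])
  set d := Module.finrank ℤ Λ + 1
  refine Summable.of_norm_bounded_eventually (hs.mul_left (d.factorial / c ^ d)) ?_
  rw [Filter.eventually_cofinite]
  refine (Set.finite_singleton (0 : Λ)).subset fun x hx => ?_
  by_contra hx0
  apply hx
  have hpos : 0 < ‖x‖ := norm_pos_iff.2 hx0
  have h1 := Real.pow_div_factorial_le_exp (x := c * ‖x‖ ^ 2) (by positivity) d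
  rw [Real.norm_eq_abs, abs_of_pos (Real.exp_pos _), neg_mul, Real.exp_neg, Real.rpow_neg hpos.le,
    show (2 * (d : ℝ)) = ((2 * d : ℕ) : ℝ) by push_cast; ring, Real.rpow_natCast,
    ← div_eq_mul_inv, div_div, ← inv_div]
  refine inv_anti₀ (by positivity) (le_trans (le_of_eq ?_) h1)
  rw [mul_pow, pow_mul]

end IsUnimodularLattice

/-! ### The automorphy factor of weight 1/2 and the inversion formula. -/

theorem norm_cexp_pi_mul_I_mul (r : ℝ) (τ : ℂ) :
    ‖Complex.exp (Real.pi * Complex.I * (r : ℂ) * τ)‖ = Real.exp (-(Real.pi * τ.im) * r) := by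
  rw [Complex.norm_exp]
  congr 1
  simp
  ring

theorem neg_I_mul_re (τ : ℂ) : (-Complex.I * τ).re = τ.im := by simp

theorem neg_I_mul_ne_zero {τ : ℂ} (hτ : 0 < τ.im) : -Complex.I * τ ≠ 0 := fun h => by
  rw [← neg_I_mul_re, h, Complex.zero_re] at hτ
  exact lt_irrefl _ hτ

theorem ne_zero_of_im_pos {τ : ℂ} (hτ : 0 < τ.im) : τ ≠ 0 := fun h => by simp [h] at hτ

theorem im_neg_one_div_pos {τ : ℂ} (hτ : 0 < τ.im) : 0 < (-1 / τ).im := by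
  rw [neg_div, one_div, Complex.neg_im, Complex.inv_im, neg_div, neg_neg]
  exact div_pos hτ (Complex.normSq_pos.2 (ne_zero_of_im_pos hτ))

/-- The square root of `-iτ` with positive real part, the automorphy factor of weight `1/2`. -/
noncomputable def thetaFactor (τ : ℂ) : ℂ := (-Complex.I * τ) ^ (1 / 2 : ℂ)

theorem thetaFactor_ne_zero {τ : ℂ} (hτ : 0 < τ.im) : thetaFactor τ ≠ 0 := by
  rw [thetaFactor, Ne, Complex.cpow_eq_zero_iff]
  exact fun h => neg_I_mul_ne_zero hτ h.1

theorem thetaFactor_sq (τ : ℂ) : thetaFactor τ ^ 2 = -Complex.I * τ := by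
  rw [thetaFactor, ← Complex.cpow_nat_mul]
  norm_num

theorem thetaFactor_inv_pow {τ : ℂ} (hτ : 0 < τ.im) (n : ℕ) :
    (1 / (-Complex.I * τ)) ^ ((n : ℂ) / 2) = (thetaFactor τ ^ n)⁻¹ := by
  have harg : (-Complex.I * τ).arg ≠ Real.pi := by
    intro h
    rw [Complex.arg_eq_pi_iff, neg_I_mul_re] at h
    linarith [h.1]
  rw [one_div, Complex.inv_cpow _ _ harg, thetaFactor, ← Complex.cpow_nat_mul]
  congr 3
  ring

namespace IsUnimodularLattice

variable {n : ℕ} {Λ : Submodule ℤ (EuclideanSpace ℝ (Fin n))}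

/-- Taking inner products with a basis identifies a unimodular lattice with `ℤⁿ`. -/
theorem exists_equiv_inner_basis (h : IsUnimodularLattice Λ) (b : Module.Basis (Fin n) ℤ Λ) :
    ∃ e : Λ ≃ (Fin n → ℤ), ∀ (x : Λ) i,
      inner ℝ (x : EuclideanSpace ℝ (Fin n)) (b i : EuclideanSpace ℝ (Fin n)) = e x i := by
  have := h.discrete
  have := h.isZLattice
  choose m hm using fun (x : Λ) i => h.integral x x.2 (b i) (b i).2
  refine ⟨Equiv.ofBijective m ⟨fun x y hxy => ?_, fun k => ?_⟩, hm⟩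
  · have h0 : (x : EuclideanSpace ℝ (Fin n)) - y = 0 := by
      refine InnerProductSpace.ext_inner_left_basis (𝕜 := ℝ) (b.ofZLatticeBasis ℝ Λ) fun i => ?_
      rw [b.ofZLatticeBasis_apply ℝ, inner_zero_right, inner_sub_right,
        real_inner_comm, hm, real_inner_comm, hm, hxy, sub_self]
    exact Subtype.ext (sub_eq_zero.1 h0)
  · obtain ⟨x, hx⟩ := h.exists_inner_basis_eq b k
    refine ⟨x, funext fun i => ?_⟩
    have := (hm x i).symm.trans (hx i)
    exact_mod_cast this

theorem summable_theta_translate (h : IsUnimodularLattice Λ) {c : ℝ} (hc : 0 < c)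
    (v : EuclideanSpace ℝ (Fin n)) :
    Summable fun x : Λ => Real.exp (-c * ‖(x : EuclideanSpace ℝ (Fin n)) + v‖ ^ 2) := by
  refine Summable.of_nonneg_of_le (fun x => (Real.exp_pos _).le) (fun x => ?_)
    ((h.summable_exp_neg_mul_norm_sq (half_pos hc)).mul_left (Real.exp (c * ‖v‖ ^ 2)))
  rw [← Real.exp_add, Real.exp_le_exp]
  have h1 := parallelogram_law_with_norm ℝ ((x : EuclideanSpace ℝ (Fin n)) + v) v
  rw [add_sub_cancel_right] at h1
  nlinarith [sq_nonneg ‖(x : EuclideanSpace ℝ (Fin n)) + v + v‖]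

/-- The substitution y ↦ y - v splits off the character value at `v` and leaves the Fourier
transform of a centred Gaussian. -/
theorem integral_exp_inner_mul_gaussian (v x : EuclideanSpace ℝ (Fin n)) {τ : ℂ}
    (hτ : 0 < τ.im) :
    ∫ y : EuclideanSpace ℝ (Fin n), Complex.exp (-(2 * Real.pi * Complex.I * (inner ℝ x y : ℝ))) *
      Complex.exp (Real.pi * Complex.I * ((‖y + v‖ ^ 2 : ℝ) : ℂ) * τ) =
    (thetaFactor τ ^ n)⁻¹ * (Complex.exp (2 * Real.pi * Complex.I * (inner ℝ x v : ℝ)) *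
      Complex.exp (Real.pi * Complex.I * ((‖x‖ ^ 2 : ℝ) : ℂ) * (-1 / τ))) := by
  have hb : 0 < (-(Real.pi * Complex.I * τ)).re := by
    simpa using mul_pos Real.pi_pos hτ
  have hG := GaussianFourier.integral_cexp_neg_mul_sq_norm_add hb (-(2 * Real.pi * Complex.I)) x
  rw [finrank_euclideanSpace_fin] at hG
  have hτ0 := ne_zero_of_im_pos hτ
  have hπ : (Real.pi : ℂ) ≠ 0 := by exact_mod_cast Real.pi_ne_zero
  rw [show (Real.pi : ℂ) / -(Real.pi * Complex.I * τ) = 1 / (-Complex.I * τ) by field_simp,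
    thetaFactor_inv_pow hτ] at hG
  rw [← integral_sub_right_eq_self _ v]
  have he : Complex.exp ((-(2 * Real.pi * Complex.I)) ^ 2 * (‖x‖ : ℂ) ^ 2 /
      (4 * -(Real.pi * Complex.I * τ))) =
      Complex.exp (Real.pi * Complex.I * ((‖x‖ ^ 2 : ℝ) : ℂ) * (-1 / τ)) := by
    congr 1
    push_cast
    field_simp
    ring
  rw [he] at hG
  rw [mul_left_comm, ← hG, ← integral_const_mul]
  refine integral_congr_ae (Filter.Eventually.of_forall fun y => ?_)
  simp only [← Complex.exp_add, sub_add_cancel, inner_sub_right]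
  congr 1
  push_cast
  ring

/-- The inversion formula for theta functions of translates of a unimodular lattice. -/
theorem tsum_translate_inversion (h : IsUnimodularLattice Λ) (v : EuclideanSpace ℝ (Fin n))
    {τ : ℂ} (hτ : 0 < τ.im) :
    ∑' x : Λ, Complex.exp (2 * Real.pi * Complex.I *
        (inner ℝ (x : EuclideanSpace ℝ (Fin n)) v : ℝ)) * Complex.exp (Real.pi * Complex.I *
        ((‖(x : EuclideanSpace ℝ (Fin n))‖ ^ 2 : ℝ) : ℂ) * (-1 / τ)) =
      thetaFactor τ ^ n * ∑' x : Λ, Complex.exp (Real.pi * Complex.I *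
        ((‖(x : EuclideanSpace ℝ (Fin n)) + v‖ ^ 2 : ℝ) : ℂ) * τ) := by
  have := h.discrete
  have := h.isZLattice
  obtain ⟨b⟩ := h.nonempty_basis
  -- Poisson summation runs over ℤⁿ in the coordinates of `b`; self-duality lets `d` index the
  -- frequencies by Λ itself.
  obtain ⟨d, hd⟩ := h.exists_equiv_inner_basis b
  set B := b.ofZLatticeBasis ℝ Λ
  set e : (Fin n → ℝ) ≃L[ℝ] EuclideanSpace ℝ (Fin n) :=
    B.equivFun.symm.toContinuousLinearEquiv
  have he : ∀ t, e t = ∑ i, t i • (b i : EuclideanSpace ℝ (Fin n)) := fun t => by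
    change B.equivFun.symm t = _
    rw [Module.Basis.equivFun_symm_apply]
    exact Finset.sum_congr rfl fun i _ => by rw [b.ofZLatticeBasis_apply ℝ]
  -- Covolume one: the change of coordinates introduces no determinant.
  have hmp : MeasurePreserving e volume volume := by
    refine ⟨e.continuous.measurable, ?_⟩
    have h1 : (Pi.basisFun ℝ (Fin n)).addHaar = volume := by
      rw [Module.Basis.addHaar_eq_iff, Module.Basis.coe_parallelepiped,
        ← measure_congr (ZSpan.fundamentalDomain_ae_parallelepiped _ _),
        ZSpan.fundamentalDomain_pi_basisFun, Real.volume_pi_Ico]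
      simp
    rw [← h1, Module.Basis.map_addHaar, ← h.addHaar_ofZLatticeBasis b]
    congr 1
    ext i : 1
    rw [Module.Basis.map_apply]
    change B.equivFun.symm _ = _
    rw [Pi.basisFun_apply, Module.Basis.equivFun_symm_apply]
    simp [Pi.single_apply, B]
  have hem : ∀ m : Fin n → ℤ, e (fun i => (m i : ℝ)) =
      (b.equivFun.symm m : EuclideanSpace ℝ (Fin n)) := fun m => by
    rw [he, Module.Basis.equivFun_symm_apply, Submodule.coe_sum]
    exact Finset.sum_congr rfl fun i _ => by
      rw [Submodule.coe_smul, ← Int.cast_smul_eq_zsmul ℝ]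
  set g : EuclideanSpace ℝ (Fin n) → ℂ := fun y =>
    Complex.exp (Real.pi * Complex.I * ((‖y + v‖ ^ 2 : ℝ) : ℂ) * τ) with hg
  have hgc : Continuous g := by fun_prop
  have hcoef : ∀ x : Λ, ∫ t : Fin n → ℝ,
      Complex.exp (-(2 * Real.pi * Complex.I * ∑ i, (d x i : ℂ) * (t i : ℂ))) * g (e t) =
      (thetaFactor τ ^ n)⁻¹ * (Complex.exp (2 * Real.pi * Complex.I *
        (inner ℝ (x : EuclideanSpace ℝ (Fin n)) v : ℝ)) * Complex.exp (Real.pi * Complex.I *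
        ((‖(x : EuclideanSpace ℝ (Fin n))‖ ^ 2 : ℝ) : ℂ) * (-1 / τ))) := by
    intro x
    rw [← integral_exp_inner_mul_gaussian v x hτ,
      ← hmp.integral_comp e.toHomeomorph.measurableEmbedding]
    refine integral_congr_ae (Filter.Eventually.of_forall fun t => ?_)
    simp only [hg]
    congr 3
    rw [he, inner_sum, Complex.ofReal_sum]
    refine congrArg _ (Finset.sum_congr rfl fun i _ => ?_)
    rw [real_inner_smul_right, hd]
    push_cast
    ring
  have hint : Integrable (fun t => g (e t)) := by
    change Integrable (g ∘ e)
    refine (hmp.integrable_comp_emb e.toHomeomorph.measurableEmbedding).2 ?_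
    have hb : 0 < (-(Real.pi * Complex.I * τ)).re := by
      simpa using mul_pos Real.pi_pos hτ
    have := (GaussianFourier.integrable_cexp_neg_mul_sq_norm_add hb 0
      (0 : EuclideanSpace ℝ (Fin n))).comp_add_right v
    refine this.congr (Filter.Eventually.of_forall fun y => ?_)
    simp [hg, mul_right_comm _ τ]
  have hu : ∀ R : ℝ, ∃ u : (Fin n → ℤ) → ℝ, Summable u ∧ ∀ t : Fin n → ℝ, ‖t‖ ≤ R →
      ∀ m, ‖g (e (t + fun i => (m i : ℝ)))‖ ≤ u m := by
    intro R
    set K := ‖(e : (Fin n → ℝ) →L[ℝ] EuclideanSpace ℝ (Fin n))‖ * R + ‖v‖ with hK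
    have hs := (h.summable_exp_neg_mul_norm_sq
      (half_pos (mul_pos Real.pi_pos hτ))).mul_left (Real.exp (Real.pi * τ.im * K ^ 2))
    refine ⟨_, b.equivFun.symm.toEquiv.summable_iff.2 hs, fun t ht m => ?_⟩
    have hz : ‖e t + v‖ ≤ K := (norm_add_le _ _).trans (add_le_add_left
      (((e : (Fin n → ℝ) →L[ℝ] EuclideanSpace ℝ (Fin n)).le_opNorm t).trans
        (mul_le_mul_of_nonneg_left ht (norm_nonneg _))) _)
    simp only [hg, Function.comp_apply]
    rw [norm_cexp_pi_mul_I_mul, map_add, hem, ← Real.exp_add, Real.exp_le_exp]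
    change _ ≤ _ + -(Real.pi * τ.im / 2) * ‖(b.equivFun.symm m : EuclideanSpace ℝ (Fin n))‖ ^ 2
    set x := (b.equivFun.symm m : EuclideanSpace ℝ (Fin n))
    have h1 := parallelogram_law_with_norm ℝ (e t + x + v) (e t + v)
    rw [show e t + x + v - (e t + v) = x by abel] at h1
    have h2 : ‖e t + v‖ ^ 2 ≤ K ^ 2 := pow_le_pow_left₀ (norm_nonneg _) hz 2
    have h3 : ‖x‖ ^ 2 ≤ 2 * ‖e t + x + v‖ ^ 2 + 2 * K ^ 2 := by
      nlinarith [sq_nonneg ‖e t + x + v + (e t + v)‖]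
    nlinarith [mul_le_mul_of_nonneg_left h3 (mul_pos Real.pi_pos hτ).le]
  have hsum : Summable fun k : Fin n → ℤ => ∫ t : Fin n → ℝ,
      Complex.exp (-(2 * Real.pi * Complex.I * ∑ i, (k i : ℂ) * (t i : ℂ))) * g (e t) := by
    rw [← d.summable_iff]
    simp only [Function.comp_def, hcoef]
    refine Summable.mul_left _ (Summable.of_norm ?_)
    refine (h.summable_exp_neg_mul_norm_sq
      (mul_pos Real.pi_pos (im_neg_one_div_pos hτ))).congr fun x => ?_
    rw [norm_mul, norm_cexp_pi_mul_I_mul, show 2 * Real.pi * Complex.I *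
      ((inner ℝ (x : EuclideanSpace ℝ (Fin n)) v : ℝ) : ℂ) =
      ((2 * Real.pi * inner ℝ (x : EuclideanSpace ℝ (Fin n)) v : ℝ) : ℂ) * Complex.I by
        push_cast; ring, Complex.norm_exp_ofReal_mul_I, one_mul]
  have hP := tsum_int_eq_tsum_integral_exp (hgc.comp e.continuous) hint hu hsum
  rw [← d.tsum_eq fun k : Fin n → ℤ => ∫ t : Fin n → ℝ,
      Complex.exp (-(2 * Real.pi * Complex.I * ∑ i, (k i : ℂ) * (t i : ℂ))) * (g ∘ e) t] at hP
  simp only [Function.comp_apply, hcoef] at hP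
  rw [tsum_mul_left] at hP
  rw [← b.equivFun.symm.toEquiv.tsum_eq fun x : Λ => Complex.exp (Real.pi * Complex.I *
        ((‖(x : EuclideanSpace ℝ (Fin n)) + v‖ ^ 2 : ℝ) : ℂ) * τ),
    eq_comm, ← eq_inv_mul_iff_mul_eq₀ (pow_ne_zero _ (thetaFactor_ne_zero hτ)), ← hP]
  refine tsum_congr fun m => ?_
  simp only [hg]
  rw [hem]
  rfl

end IsUnimodularLattice

/-! ### Vanishing of level one forms of high order at infinity. -/

open UpperHalfPlane ModularForm MatrixGroups SlashInvariantForm in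
/-- A holomorphic function on the upper half plane which transforms like a level one modular form
of weight `12k` and vanishes to order more than `k` at infinity is zero. -/
theorem eq_zero_of_level_one_of_decay {N : ℂ → ℂ} {k : ℕ}
    (hd : DifferentiableOn ℂ N {z | 0 < z.im}) (hT : ∀ τ : ℂ, 0 < τ.im → N (τ + 1) = N τ)
    (hS : ∀ τ : ℂ, 0 < τ.im → N (-1 / τ) = τ ^ (12 * k) * N τ)
    (hb : ∃ C : ℝ, ∀ τ : ℂ, 1 ≤ τ.im → ‖N τ‖ ≤ C * Real.exp (-(2 * Real.pi * (k + 1) * τ.im)))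
    {τ : ℂ} (hτ : 0 < τ.im) : N τ = 0 := by
  -- The quotient by Δ^k has weight zero and tends to 0 at infinity, since `N` decays by one more
  -- factor exp(-2π Im τ) than Δ^k. Level one forms of weight zero are constant.
  set R : ℍ → ℂ := fun z => N z / discriminant z ^ k with hR
  have hΔS : ∀ z : ℍ, discriminant (ModularGroup.S • z) = (z : ℂ) ^ 12 * discriminant z := by
    intro z
    have h1 := congrFun discriminant_S_invariant z
    rw [SL_slash_apply, ModularGroup.denom_S] at h1
    rw [← h1, mul_comm, mul_assoc, zpow_neg, inv_mul_eq_div, ← zpow_natCast]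
    exact (div_self (zpow_ne_zero _ z.ne_zero) ▸ (mul_one _).symm)
  have hΔT : ∀ z : ℍ, discriminant (ModularGroup.T • z) = discriminant z := by
    intro z
    have h1 := congrFun discriminant_T_invariant z
    rw [SL_slash_apply] at h1
    have h2 : denom (ModularGroup.T : GL (Fin 2) ℝ) z = 1 := by
      rw [ModularGroup.denom_apply, ModularGroup.coe_T]
      simp
    rw [h2, one_zpow, mul_one] at h1
    exact h1
  have hRS : R ∣[(0 : ℤ)] ModularGroup.S = R := by
    ext z
    rw [SL_slash_apply]
    simp only [hR, neg_zero, zpow_zero, mul_one]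
    rw [hΔS, modular_S_smul, UpperHalfPlane.coe_mk, inv_neg, ← one_div, ← neg_div, hS _ z.im_pos, mul_pow,
      ← pow_mul, mul_div_mul_left _ _ (pow_ne_zero _ z.ne_zero)]
  have hRT : R ∣[(0 : ℤ)] ModularGroup.T = R := by
    ext z
    rw [SL_slash_apply]
    simp only [hR, neg_zero, zpow_zero, mul_one]
    rw [hΔT, modular_T_smul, coe_vadd, Complex.ofReal_one, add_comm, hT _ z.im_pos]
  have hinv := slash_action_generators_SL2Z hRS hRT
  have hzero : Filter.Tendsto R atImInfty (nhds 0) := by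
    obtain ⟨C, hC⟩ := hb
    obtain ⟨c, hc⟩ := exp_isBigO_discriminant.bound
    have him : Filter.Tendsto (fun z : ℍ => z.im) atImInfty Filter.atTop :=
      Filter.tendsto_comap
    have hlim : Filter.Tendsto
        (fun z : ℍ => |C| * |c| ^ k * Real.exp (-(2 * Real.pi) * z.im)) atImInfty (nhds 0) := by
      rw [← mul_zero (|C| * |c| ^ k)]
      refine Filter.Tendsto.const_mul _ (Real.tendsto_exp_atBot.comp ?_)
      exact him.const_mul_atTop_of_neg (by linarith [Real.pi_pos])
    refine squeeze_zero_norm' ?_ hlim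
    filter_upwards [hc, him.eventually_ge_atTop 1] with z hz hz1
    have hΔ0 := norm_pos_iff.2 (discriminant_ne_zero z)
    rw [hR, norm_div, norm_pow, div_le_iff₀ (pow_pos hΔ0 _)]
    rw [Real.norm_of_nonneg (Real.exp_pos _).le] at hz
    have h1 : Real.exp (-2 * Real.pi * z.im) ^ k ≤ |c| ^ k * ‖discriminant z‖ ^ k := by
      rw [← mul_pow]
      refine pow_le_pow_left₀ (Real.exp_pos _).le (hz.trans ?_) k
      exact mul_le_mul_of_nonneg_right (le_abs_self c) hΔ0.le
    calc ‖N z‖ ≤ C * Real.exp (-(2 * Real.pi * (k + 1) * z.im)) := hC z hz1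
      _ ≤ |C| * Real.exp (-(2 * Real.pi * (k + 1) * z.im)) :=
        mul_le_mul_of_nonneg_right (le_abs_self C) (Real.exp_pos _).le
      _ = |C| * Real.exp (-(2 * Real.pi) * z.im) * Real.exp (-2 * Real.pi * z.im) ^ k := by
        rw [mul_assoc |C|, ← Real.exp_nat_mul, ← Real.exp_add]
        congr 2
        ring
      _ ≤ |C| * Real.exp (-(2 * Real.pi) * z.im) * (|c| ^ k * ‖discriminant z‖ ^ k) :=
        mul_le_mul_of_nonneg_left h1 (by positivity)
      _ = _ := by ring
  let F : ModularForm 𝒮ℒ 0 :=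
    { toFun := R
      slash_action_eq' := fun _ ⟨γ, hγ⟩ => hγ ▸ hinv γ
      holo' := by
        refine MDifferentiable.div ?_ (CuspForm.discriminant.holo'.pow k)
          fun z => pow_ne_zero _ (discriminant_ne_zero z)
        rw [UpperHalfPlane.mdifferentiable_iff]
        exact hd.congr fun z hz => by simp [ofComplex_apply_of_im_pos hz]
      bdd_at_cusps' := fun {c} hc => by
        rw [Subgroup.IsArithmetic.isCusp_iff_isCusp_SL2Z] at hc
        rw [OnePoint.isBoundedAt_iff_forall_SL2Z hc]
        intro γ _
        rw [hinv γ]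
        exact hzero.isBigO_one ℝ }
  obtain ⟨c, hc⟩ := ModularFormClass.levelOne_weight_zero_const F
  have hc' : ∀ z, R z = c := fun z => congrFun hc z
  have hc0 : c = 0 := tendsto_nhds_unique
    (tendsto_const_nhds.congr fun z => (hc' z).symm) hzero
  have := hc' ⟨τ, hτ⟩
  rw [hc0, hR, div_eq_zero_iff] at this
  exact this.resolve_right (pow_ne_zero _ (discriminant_ne_zero _))

/-! ### Theta triples under the modular group. -/

theorem thetaFactor_mul_thetaFactor_neg_one_div {τ : ℂ} (hτ : 0 < τ.im) :
    thetaFactor τ * thetaFactor (-1 / τ) = 1 := by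
  have h1 := thetaFactor_inv_pow hτ 1
  have h2 : thetaFactor (-1 / τ) = (thetaFactor τ)⁻¹ := by
    rw [pow_one] at h1
    rw [← h1, thetaFactor]
    congr 1
    · have := ne_zero_of_im_pos hτ
      field_simp
      rw [Complex.I_sq]
    · norm_num
  rw [h2, mul_inv_cancel₀ (thetaFactor_ne_zero hτ)]

/-- The factor by which the shadow component of a theta triple of weight `1/2` changes under
`τ ↦ τ + 1`. -/
noncomputable def shadowFactor (τ : ℂ) : ℂ :=
  thetaFactor τ * thetaFactor (-1 - 1 / τ) / thetaFactor (τ + 1)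

/-- Squaring removes the roots in `thetaFactor`, and the resulting rational function of τ is the
constant i. -/
theorem shadowFactor_pow_four {τ : ℂ} (hτ : 0 < τ.im) : shadowFactor τ ^ 4 = -1 := by
  have h0 := ne_zero_of_im_pos hτ
  have h1 : τ + 1 ≠ 0 := ne_zero_of_im_pos (by simpa using hτ)
  have h2 : shadowFactor τ ^ 2 = Complex.I := by
    rw [shadowFactor, div_pow, mul_pow, thetaFactor_sq, thetaFactor_sq, thetaFactor_sq]
    field_simp
    ring
  rw [show 4 = 2 * 2 from rfl, pow_mul, h2, Complex.I_sq]

theorem shadowFactor_pow_eight {τ : ℂ} (hτ : 0 < τ.im) : shadowFactor τ ^ 8 = 1 := by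
  rw [show 8 = 4 * 2 from rfl, pow_mul, shadowFactor_pow_four hτ, neg_one_sq]

/-- The three functions `f`, `f (· + 1)` and the shadow of `f`, permuted by the modular group in
weight `n / 2`. -/
structure IsThetaTriple (n : ℕ) (f g h : ℂ → ℂ) : Prop where
  differentiableOn_fst : DifferentiableOn ℂ f {z | 0 < z.im}
  differentiableOn_snd : DifferentiableOn ℂ g {z | 0 < z.im}
  differentiableOn_shadow : DifferentiableOn ℂ h {z | 0 < z.im}
  fst_add_one : ∀ τ : ℂ, 0 < τ.im → f (τ + 1) = g τ
  snd_add_one : ∀ τ : ℂ, 0 < τ.im → g (τ + 1) = f τ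
  fst_inv : ∀ τ : ℂ, 0 < τ.im → f (-1 / τ) = thetaFactor τ ^ n * f τ
  snd_inv : ∀ τ : ℂ, 0 < τ.im → g (-1 / τ) = thetaFactor τ ^ n * h τ

namespace IsThetaTriple

variable {n n' : ℕ} {f g h f' g' h' : ℂ → ℂ}

theorem mul (H : IsThetaTriple n f g h) (H' : IsThetaTriple n' f' g' h') :
    IsThetaTriple (n + n') (f * f') (g * g') (h * h') where
  differentiableOn_fst := H.differentiableOn_fst.mul H'.differentiableOn_fst
  differentiableOn_snd := H.differentiableOn_snd.mul H'.differentiableOn_snd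
  differentiableOn_shadow := H.differentiableOn_shadow.mul H'.differentiableOn_shadow
  fst_add_one τ hτ := by simp only [Pi.mul_apply, H.fst_add_one τ hτ, H'.fst_add_one τ hτ]
  snd_add_one τ hτ := by simp only [Pi.mul_apply, H.snd_add_one τ hτ, H'.snd_add_one τ hτ]
  fst_inv τ hτ := by simp only [Pi.mul_apply, H.fst_inv τ hτ, H'.fst_inv τ hτ]; ring
  snd_inv τ hτ := by simp only [Pi.mul_apply, H.snd_inv τ hτ, H'.snd_inv τ hτ]; ring

theorem pow (H : IsThetaTriple n f g h) (k : ℕ) :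
    IsThetaTriple (n * k) (f ^ k) (g ^ k) (h ^ k) where
  differentiableOn_fst := H.differentiableOn_fst.pow k
  differentiableOn_snd := H.differentiableOn_snd.pow k
  differentiableOn_shadow := H.differentiableOn_shadow.pow k
  fst_add_one τ hτ := by simp only [Pi.pow_apply, H.fst_add_one τ hτ]
  snd_add_one τ hτ := by simp only [Pi.pow_apply, H.snd_add_one τ hτ]
  fst_inv τ hτ := by simp only [Pi.pow_apply, H.fst_inv τ hτ]; ring
  snd_inv τ hτ := by simp only [Pi.pow_apply, H.snd_inv τ hτ]; ring

theorem add (H : IsThetaTriple n f g h) (H' : IsThetaTriple n f' g' h') :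
    IsThetaTriple n (f + f') (g + g') (h + h') where
  differentiableOn_fst := H.differentiableOn_fst.add H'.differentiableOn_fst
  differentiableOn_snd := H.differentiableOn_snd.add H'.differentiableOn_snd
  differentiableOn_shadow := H.differentiableOn_shadow.add H'.differentiableOn_shadow
  fst_add_one τ hτ := by simp only [Pi.add_apply, H.fst_add_one τ hτ, H'.fst_add_one τ hτ]
  snd_add_one τ hτ := by simp only [Pi.add_apply, H.snd_add_one τ hτ, H'.snd_add_one τ hτ]
  fst_inv τ hτ := by simp only [Pi.add_apply, H.fst_inv τ hτ, H'.fst_inv τ hτ]; ring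
  snd_inv τ hτ := by simp only [Pi.add_apply, H.snd_inv τ hτ, H'.snd_inv τ hτ]; ring

theorem smul (H : IsThetaTriple n f g h) (c : ℂ) : IsThetaTriple n (c • f) (c • g) (c • h) where
  differentiableOn_fst := H.differentiableOn_fst.const_smul c
  differentiableOn_snd := H.differentiableOn_snd.const_smul c
  differentiableOn_shadow := H.differentiableOn_shadow.const_smul c
  fst_add_one τ hτ := by simp only [Pi.smul_apply, H.fst_add_one τ hτ]
  snd_add_one τ hτ := by simp only [Pi.smul_apply, H.snd_add_one τ hτ]
  fst_inv τ hτ := by simp only [Pi.smul_apply, H.fst_inv τ hτ, smul_eq_mul]; ring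
  snd_inv τ hτ := by simp only [Pi.smul_apply, H.snd_inv τ hτ, smul_eq_mul]; ring

theorem shadow_inv (H : IsThetaTriple n f g h) (τ : ℂ) (hτ : 0 < τ.im) :
    h (-1 / τ) = thetaFactor τ ^ n * g τ := by
  have h1 := H.snd_inv (-1 / τ) (im_neg_one_div_pos hτ)
  have h0 := ne_zero_of_im_pos hτ
  rw [show -1 / (-1 / τ) = τ by field_simp] at h1
  rw [h1, ← mul_assoc, ← mul_pow, thetaFactor_mul_thetaFactor_neg_one_div hτ, one_pow, one_mul]

/-- The relation between the two generators of the modular group: τ/(τ + 1) equals both 1 - 1/(τ +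
1) and -1/(-1 - 1/τ), so `f` can be evaluated there in two ways. -/
theorem shadow_add_one (H : IsThetaTriple n f g h) (τ : ℂ) (hτ : 0 < τ.im) :
    h (τ + 1) = shadowFactor τ ^ n * h τ := by
  have h0 := ne_zero_of_im_pos hτ
  have hτ1 : 0 < (τ + 1).im := by simpa using hτ
  have h1 := ne_zero_of_im_pos hτ1
  have hρ : 0 < (-1 - 1 / τ).im := by
    have := im_neg_one_div_pos hτ
    rw [neg_div] at this
    simpa [sub_eq_add_neg] using this
  have e1 := H.snd_inv (τ + 1) hτ1
  have e2 := H.fst_add_one _ (im_neg_one_div_pos hτ1)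
  have e3 := H.fst_inv _ hρ
  have e4 := H.snd_add_one _ hρ
  have e5 := H.snd_inv τ hτ
  rw [show -1 / (τ + 1) + 1 = -1 / (-1 - 1 / τ) by
    rw [show -1 - 1 / τ = -(τ + 1) / τ by field_simp; ring]
    field_simp
    ring] at e2
  rw [show -1 - 1 / τ + 1 = -1 / τ by ring] at e4
  rw [shadowFactor, div_pow, mul_pow, div_mul_eq_mul_div,
    eq_div_iff (pow_ne_zero _ (thetaFactor_ne_zero hτ1)), mul_comm, ← e1, ← e2, e3, ← e4, e5]
  ring

/-- The weight four triple `θ₂⁴θ₄⁴`, `-θ₂⁴θ₃⁴`, `-θ₃⁴θ₄⁴`. -/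
theorem delta (H : IsThetaTriple 1 f g h) :
    IsThetaTriple 8 (h ^ 4 * g ^ 4) (-(h ^ 4 * f ^ 4)) (-(f ^ 4 * g ^ 4)) where
  differentiableOn_fst := (H.differentiableOn_shadow.pow 4).mul (H.differentiableOn_snd.pow 4)
  differentiableOn_snd := ((H.differentiableOn_shadow.pow 4).mul (H.differentiableOn_fst.pow 4)).neg
  differentiableOn_shadow :=
    ((H.differentiableOn_fst.pow 4).mul (H.differentiableOn_snd.pow 4)).neg
  fst_add_one τ hτ := by
    simp only [Pi.mul_apply, Pi.pow_apply, Pi.neg_apply, H.shadow_add_one τ hτ,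
      H.snd_add_one τ hτ, pow_one]
    rw [mul_pow, shadowFactor_pow_four hτ]
    ring
  snd_add_one τ hτ := by
    simp only [Pi.mul_apply, Pi.pow_apply, Pi.neg_apply, H.shadow_add_one τ hτ,
      H.fst_add_one τ hτ, pow_one]
    rw [mul_pow, shadowFactor_pow_four hτ]
    ring
  fst_inv τ hτ := by
    simp only [Pi.mul_apply, Pi.pow_apply, H.shadow_inv τ hτ, H.snd_inv τ hτ]
    ring
  snd_inv τ hτ := by
    simp only [Pi.mul_apply, Pi.pow_apply, Pi.neg_apply, H.shadow_inv τ hτ, H.fst_inv τ hτ]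
    ring

/-- The generators permute f, g, h up to automorphy factors and powers of `shadowFactor`; the eighth
power of f g h kills the latter and has weight 12(m + 24). Its order in exp(2πiτ) is at least 8(2 +
2 + m/8) = m + 32, beyond the required m + 25. By the identity theorem one factor vanishes
identically, and the transformation laws pass this on to `h`. -/
theorem shadow_eq_zero (m : ℕ) (H : IsThetaTriple (m + 24) f g h)
    (hf : ∃ C : ℝ, ∀ τ : ℂ, 1 ≤ τ.im → ‖f τ‖ ≤ C * Real.exp (-(4 * Real.pi * τ.im)))
    (hh : ∃ C : ℝ, ∀ τ : ℂ, 1 ≤ τ.im → ‖h τ‖ ≤ C * Real.exp (-(m / 4 * Real.pi * τ.im)))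
    {τ : ℂ} (hτ : 0 < τ.im) : h τ = 0 := by
  have hN : ∀ τ : ℂ, 0 < τ.im → ((f * g * h) ^ 8) τ = 0 := by
    intro τ hτ
    refine eq_zero_of_level_one_of_decay (k := m + 24) ?_ (fun τ hτ => ?_) (fun τ hτ => ?_) ?_ hτ
    · exact ((H.differentiableOn_fst.mul H.differentiableOn_snd).mul
        H.differentiableOn_shadow).pow 8
    · simp only [Pi.pow_apply, Pi.mul_apply]
      rw [H.fst_add_one τ hτ, H.snd_add_one τ hτ, H.shadow_add_one τ hτ]
      have := shadowFactor_pow_eight hτ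
      calc (g τ * f τ * (shadowFactor τ ^ (m + 24) * h τ)) ^ 8
          = (g τ * f τ * h τ) ^ 8 * (shadowFactor τ ^ 8) ^ (m + 24) := by ring
        _ = _ := by rw [this, one_pow]; ring
    · simp only [Pi.pow_apply, Pi.mul_apply]
      rw [H.fst_inv τ hτ, H.snd_inv τ hτ, H.shadow_inv τ hτ]
      calc _ = (f τ * g τ * h τ) ^ 8 * (((thetaFactor τ ^ 2) ^ 4) ^ (m + 24)) ^ 3 := by ring
        _ = _ := by
          rw [thetaFactor_sq, mul_pow (-Complex.I), neg_pow, Complex.I_pow_four]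
          ring
    · obtain ⟨C, hC⟩ := hf
      obtain ⟨D, hD⟩ := hh
      refine ⟨(C * C * D) ^ 8, fun τ hτ => ?_⟩
      have hg : ‖g τ‖ ≤ C * Real.exp (-(4 * Real.pi * τ.im)) := by
        rw [← H.fst_add_one τ (by linarith)]
        simpa using hC (τ + 1) (by simpa using hτ)
      rw [Pi.pow_apply, Pi.mul_apply, Pi.mul_apply, norm_pow, norm_mul, norm_mul]
      have hC0 : 0 ≤ C * Real.exp (-(4 * Real.pi * τ.im)) := (norm_nonneg _).trans (hC τ hτ)
      calc _ ≤ (C * Real.exp (-(4 * Real.pi * τ.im)) * (C * Real.exp (-(4 * Real.pi * τ.im))) *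
            (D * Real.exp (-(m / 4 * Real.pi * τ.im)))) ^ 8 := by
            gcongr
            · exact hC τ hτ
            · exact hD τ hτ
        _ = (C * C * D) ^ 8 * (Real.exp (-(4 * Real.pi * τ.im)) *
            Real.exp (-(4 * Real.pi * τ.im)) * Real.exp (-(m / 4 * Real.pi * τ.im))) ^ 8 := by
            ring
        _ ≤ _ := by
          refine mul_le_mul_of_nonneg_left ?_ (Even.pow_nonneg (by decide) _)
          rw [← Real.exp_add, ← Real.exp_add, ← Real.exp_nat_mul, Real.exp_le_exp]
          push_cast
          nlinarith [Real.pi_pos, mul_pos Real.pi_pos (show 0 < τ.im by linarith)]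
  have hopen : IsOpen {z : ℂ | 0 < z.im} := isOpen_lt continuous_const Complex.continuous_im
  have hconn : IsPreconnected {z : ℂ | 0 < z.im} := (convex_halfSpace_im_gt 0).isPreconnected
  have hprod : ∀ z ∈ {z : ℂ | 0 < z.im}, (f * g) z * h z = 0 := fun z hz => by
    have := hN z hz
    rw [Pi.pow_apply] at this
    exact pow_eq_zero_iff (by norm_num) |>.1 this
  have ha := fun {u : ℂ → ℂ} (hu : DifferentiableOn ℂ u {z : ℂ | 0 < z.im}) =>
    hu.analyticOnNhd hopen
  have hg0 : (∀ z : ℂ, 0 < z.im → g z = 0) → h τ = 0 := fun hg => by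
    have := H.snd_inv τ hτ
    rw [hg _ (im_neg_one_div_pos hτ), eq_comm, mul_eq_zero] at this
    exact this.resolve_left (pow_ne_zero _ (thetaFactor_ne_zero hτ))
  rcases AnalyticOnNhd.eq_zero_or_eq_zero_of_mul_eq_zero
    (ha (H.differentiableOn_fst.mul H.differentiableOn_snd)) (ha H.differentiableOn_shadow)
    hprod hconn with h1 | h1
  · rcases AnalyticOnNhd.eq_zero_or_eq_zero_of_mul_eq_zero
      (ha H.differentiableOn_fst) (ha H.differentiableOn_snd) h1 hconn with h2 | h2
    · refine hg0 fun z hz => ?_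
      rw [← H.fst_add_one z hz]
      exact h2 _ (by simpa using hz)
    · exact hg0 h2
  · exact h1 τ hτ

end IsThetaTriple

/-! ### Expansions in the nome up to q³. -/

/-- The nome `q = exp (πiτ)`. -/
noncomputable def thetaNome (τ : ℂ) : ℂ := Complex.exp (Real.pi * Complex.I * τ)

theorem thetaNome_ne_zero (τ : ℂ) : thetaNome τ ≠ 0 := Complex.exp_ne_zero _

theorem norm_thetaNome (τ : ℂ) : ‖thetaNome τ‖ = Real.exp (-(Real.pi * τ.im)) := by
  have := norm_cexp_pi_mul_I_mul 1 τ
  simpa [thetaNome] using this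

theorem thetaNome_pow (τ : ℂ) (r : ℕ) :
    thetaNome τ ^ r = Complex.exp (Real.pi * Complex.I * ((r : ℝ) : ℂ) * τ) := by
  rw [thetaNome, ← Complex.exp_nat_mul]
  congr 1
  push_cast
  ring

theorem thetaNome_add_one (τ : ℂ) : thetaNome (τ + 1) = -thetaNome τ := by
  rw [thetaNome, mul_add, Complex.exp_add, mul_one, Complex.exp_pi_mul_I, mul_neg_one, thetaNome]

/-- The filter of neighbourhoods of the cusp given by the half plane `1 ≤ Im τ`. -/
def cuspFilter : Filter ℂ := Filter.principal {τ | 1 ≤ τ.im}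

theorem thetaNome_isBigO_one : thetaNome =O[cuspFilter] (1 : ℂ → ℝ) := by
  refine Asymptotics.IsBigO.of_bound 1 (Filter.eventually_principal.2 fun τ hτ => ?_)
  rw [norm_thetaNome, Pi.one_apply, norm_one, mul_one, Real.exp_le_one_iff]
  have : (1 : ℝ) ≤ τ.im := hτ
  nlinarith [Real.pi_pos]

theorem const_isBigO_one (c : ℂ) : (fun _ => c) =O[cuspFilter] (1 : ℂ → ℝ) :=
  Asymptotics.isBigO_const_const c one_ne_zero _

/-- `f = a₀ + a₁ q + a₂ q² + a₃ q³ + O(q⁴)` on the half plane `1 ≤ Im τ`. -/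
def HasThetaExpansion (f : ℂ → ℂ) (a₀ a₁ a₂ a₃ : ℂ) : Prop :=
  ∃ e : ℂ → ℂ, e =O[cuspFilter] (1 : ℂ → ℝ) ∧ ∀ τ : ℂ, 1 ≤ τ.im → f τ = a₀ + a₁ * thetaNome τ +
    a₂ * thetaNome τ ^ 2 + a₃ * thetaNome τ ^ 3 + thetaNome τ ^ 4 * e τ

theorem isBigO_one_mul {e e' : ℂ → ℂ} (h : e =O[cuspFilter] (1 : ℂ → ℝ))
    (h' : e' =O[cuspFilter] (1 : ℂ → ℝ)) : (fun τ => e τ * e' τ) =O[cuspFilter] (1 : ℂ → ℝ) :=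
  (h.mul h').congr_right fun _ => one_mul 1

theorem const_mul_thetaNome_pow_isBigO_one (c : ℂ) (k : ℕ) :
    (fun τ => c * thetaNome τ ^ k) =O[cuspFilter] (1 : ℂ → ℝ) :=
  ((thetaNome_isBigO_one.pow k).const_mul_left c).congr_right fun _ => one_pow k

namespace HasThetaExpansion

variable {f f' : ℂ → ℂ} {a₀ a₁ a₂ a₃ b₀ b₁ b₂ b₃ : ℂ}

theorem one : HasThetaExpansion 1 1 0 0 0 :=
  ⟨fun _ => 0, const_isBigO_one 0, fun τ _ => by simp⟩

theorem add (h : HasThetaExpansion f a₀ a₁ a₂ a₃) (h' : HasThetaExpansion f' b₀ b₁ b₂ b₃) :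
    HasThetaExpansion (f + f') (a₀ + b₀) (a₁ + b₁) (a₂ + b₂) (a₃ + b₃) := by
  obtain ⟨e, he, hf⟩ := h
  obtain ⟨e', he', hf'⟩ := h'
  refine ⟨fun τ => e τ + e' τ, he.add he', fun τ hτ => ?_⟩
  rw [Pi.add_apply, hf τ hτ, hf' τ hτ]
  ring

theorem smul (h : HasThetaExpansion f a₀ a₁ a₂ a₃) (c : ℂ) :
    HasThetaExpansion (c • f) (c * a₀) (c * a₁) (c * a₂) (c * a₃) := by
  obtain ⟨e, he, hf⟩ := h
  refine ⟨fun τ => c * e τ, he.const_mul_left c, fun τ hτ => ?_⟩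
  rw [Pi.smul_apply, hf τ hτ, smul_eq_mul]
  ring

theorem mul (h : HasThetaExpansion f a₀ a₁ a₂ a₃) (h' : HasThetaExpansion f' b₀ b₁ b₂ b₃) :
    HasThetaExpansion (f * f') (a₀ * b₀) (a₀ * b₁ + a₁ * b₀) (a₀ * b₂ + a₁ * b₁ + a₂ * b₀)
      (a₀ * b₃ + a₁ * b₂ + a₂ * b₁ + a₃ * b₀) := by
  obtain ⟨e, he, hf⟩ := h
  obtain ⟨e', he', hf'⟩ := h'
  have hq' := const_mul_thetaNome_pow_isBigO_one
  refine ⟨fun τ => (a₁ * b₃ + a₂ * b₂ + a₃ * b₁) * thetaNome τ ^ 0 +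
    (a₂ * b₃ + a₃ * b₂) * thetaNome τ ^ 1 + (a₃ * b₃) * thetaNome τ ^ 2 +
    (a₀ * thetaNome τ ^ 0 + a₁ * thetaNome τ ^ 1 + a₂ * thetaNome τ ^ 2 + a₃ * thetaNome τ ^ 3)
      * e' τ +
    (b₀ * thetaNome τ ^ 0 + b₁ * thetaNome τ ^ 1 + b₂ * thetaNome τ ^ 2 + b₃ * thetaNome τ ^ 3)
      * e τ +
    1 * thetaNome τ ^ 4 * (e τ * e' τ), ?_, fun τ hτ => ?_⟩
  · exact (((((hq' _ 0).add (hq' _ 1)).add (hq' _ 2)).add (isBigO_one_mul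
      ((((hq' _ 0).add (hq' _ 1)).add (hq' _ 2)).add (hq' _ 3)) he')).add (isBigO_one_mul
      ((((hq' _ 0).add (hq' _ 1)).add (hq' _ 2)).add (hq' _ 3)) he)).add
      (isBigO_one_mul (hq' 1 4) (isBigO_one_mul he he'))
  · rw [Pi.mul_apply, hf τ hτ, hf' τ hτ]
    ring

theorem congr (h : HasThetaExpansion f a₀ a₁ a₂ a₃) (h₀ : a₀ = b₀) (h₁ : a₁ = b₁) (h₂ : a₂ = b₂)
    (h₃ : a₃ = b₃) : HasThetaExpansion f b₀ b₁ b₂ b₃ := by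
  subst h₀ h₁ h₂ h₃
  exact h

/-- The q³ coefficient can stay unspecified: later it is either absorbed into the free constant of
the combination or discarded. -/
theorem pow (h : HasThetaExpansion f 1 a₁ a₂ a₃) (k : ℕ) : ∃ c,
    HasThetaExpansion (f ^ k) 1 (k * a₁) (k * a₂ + k * (k - 1) / 2 * a₁ ^ 2) c := by
  induction k with
  | zero =>
    refine ⟨0, ?_⟩
    rw [pow_zero]
    exact one.congr rfl (by simp) (by simp) rfl
  | succ k ih =>
    obtain ⟨c, hc⟩ := ih
    refine ⟨_, (pow_succ f k ▸ hc.mul h).congr (by ring) (by push_cast; ring)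
      (by push_cast; ring) rfl⟩

theorem comp_add_one (h : HasThetaExpansion f a₀ a₁ a₂ a₃) :
    HasThetaExpansion (fun τ => f (τ + 1)) a₀ (-a₁) a₂ (-a₃) := by
  obtain ⟨e, he, hf⟩ := h
  refine ⟨fun τ => e (τ + 1), he.comp_tendsto (Filter.tendsto_principal_principal.2 fun τ hτ => ?_),
    fun τ hτ => ?_⟩
  · simpa using hτ
  · dsimp only
    rw [hf (τ + 1) (by simpa using hτ), thetaNome_add_one]
    ring

theorem thetaNome_mul (h : HasThetaExpansion f a₀ a₁ a₂ a₃) :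
    HasThetaExpansion (fun τ => thetaNome τ * f τ) 0 a₀ a₁ a₂ := by
  obtain ⟨e, he, hf⟩ := h
  refine ⟨fun τ => a₃ + thetaNome τ * e τ,
    (const_isBigO_one _).add (isBigO_one_mul thetaNome_isBigO_one he), fun τ hτ => ?_⟩
  dsimp only
  rw [hf τ hτ]
  ring

theorem isBigO_one (h : HasThetaExpansion f a₀ a₁ a₂ a₃) : f =O[cuspFilter] (1 : ℂ → ℝ) := by
  obtain ⟨e, he, hf⟩ := h
  have hq' := const_mul_thetaNome_pow_isBigO_one
  refine (((((hq' a₀ 0).add (hq' a₁ 1)).add (hq' a₂ 2)).add (hq' a₃ 3)).add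
    (isBigO_one_mul (hq' 1 4) he)).congr' (Filter.eventually_principal.2 fun τ hτ => ?_)
    Filter.EventuallyEq.rfl
  rw [hf τ hτ]
  ring

end HasThetaExpansion

/-- Along τ = iy, y → ∞, the nome tends to 0 while `e` stays bounded. -/
theorem eq_zero_of_add_thetaNome_mul {c : ℂ} {e : ℂ → ℂ} (he : e =O[cuspFilter] (1 : ℂ → ℝ))
    (h : ∀ τ : ℂ, 1 ≤ τ.im → c + thetaNome τ * e τ = 0) : c = 0 := by
  obtain ⟨C, hC⟩ := he.bound
  rw [cuspFilter, Filter.eventually_principal] at hC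
  have hlim : Filter.Tendsto (fun y : ℝ => Real.exp (-(Real.pi * y)) * C) Filter.atTop
      (nhds (0 * C)) := by
    refine (Real.tendsto_exp_atBot.comp ?_).mul_const C
    exact Filter.tendsto_neg_atTop_atBot.comp (Filter.tendsto_id.const_mul_atTop Real.pi_pos)
  rw [zero_mul] at hlim
  rw [← norm_le_zero_iff]
  refine ge_of_tendsto hlim ((Filter.eventually_ge_atTop 1).mono fun y hy => ?_)
  have him : ((y : ℂ) * Complex.I).im = y := by simp
  have h1 := h (y * Complex.I) (by rwa [him])
  have h2 := hC (y * Complex.I) (by simpa using hy)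
  rw [Pi.one_apply, norm_one, mul_one] at h2
  rw [add_eq_zero_iff_eq_neg.1 h1, norm_neg, norm_mul, norm_thetaNome, him]
  exact mul_le_mul_of_nonneg_left h2 (Real.exp_pos _).le

theorem HasThetaExpansion.coeff_eq_zero {f : ℂ → ℂ} {a₀ a₁ a₂ a₃ : ℂ}
    (h : HasThetaExpansion f a₀ a₁ a₂ a₃) (hf : ∀ τ : ℂ, 1 ≤ τ.im → f τ = 0) :
    a₀ = 0 ∧ a₁ = 0 ∧ a₂ = 0 := by
  obtain ⟨e, he, hfe⟩ := h
  have hq' := const_mul_thetaNome_pow_isBigO_one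
  have h0 : a₀ = 0 := eq_zero_of_add_thetaNome_mul
    (e := fun τ => a₁ * thetaNome τ ^ 0 + a₂ * thetaNome τ ^ 1 + a₃ * thetaNome τ ^ 2 +
      1 * thetaNome τ ^ 3 * e τ)
    ((((hq' _ 0).add (hq' _ 1)).add (hq' _ 2)).add (isBigO_one_mul (hq' 1 3) he))
    fun τ hτ => by rw [← hf τ hτ, hfe τ hτ]; ring
  subst h0
  have h1 : a₁ = 0 := eq_zero_of_add_thetaNome_mul
    (e := fun τ => a₂ * thetaNome τ ^ 0 + a₃ * thetaNome τ ^ 1 + 1 * thetaNome τ ^ 2 * e τ)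
    (((hq' _ 0).add (hq' _ 1)).add (isBigO_one_mul (hq' 1 2) he))
    fun τ hτ => mul_left_cancel₀ (thetaNome_ne_zero τ)
      (by rw [mul_zero, ← hf τ hτ, hfe τ hτ]; ring)
  subst h1
  have h2 : a₂ = 0 := eq_zero_of_add_thetaNome_mul
    (e := fun τ => a₃ * thetaNome τ ^ 0 + 1 * thetaNome τ ^ 1 * e τ)
    ((hq' _ 0).add (isBigO_one_mul (hq' 1 1) he))
    fun τ hτ => mul_left_cancel₀ (pow_ne_zero 2 (thetaNome_ne_zero τ))
      (by rw [mul_zero, ← hf τ hτ, hfe τ hτ]; ring)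
  exact ⟨rfl, rfl, h2⟩

/-! ### Series with natural number exponents. -/

/-- The series `∑ᵢ q ^ rᵢ`. -/
noncomputable def thetaSeries {ι : Type*} (r : ι → ℕ) (τ : ℂ) : ℂ := ∑' i, thetaNome τ ^ r i

theorem summable_thetaNome_pow {ι : Type*} {r : ι → ℕ} {τ : ℂ}
    (hr : Summable fun i => Real.exp (-(Real.pi * τ.im)) ^ r i) :
    Summable fun i => thetaNome τ ^ r i :=
  Summable.of_norm (hr.congr fun i => by rw [norm_pow, norm_thetaNome])

/-- Terms of a summable family tend to 0, so only finitely many exponents are below 4. The remaining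
terms, divided by q⁴, are dominated on Im τ ≥ 1 by their values at height 1. -/
theorem hasThetaExpansion_thetaSeries {ι : Type*} {r : ι → ℕ}
    (hr : ∀ y : ℝ, 0 < y → Summable fun i => Real.exp (-(Real.pi * y)) ^ r i) :
    HasThetaExpansion (thetaSeries r) {i | r i = 0}.ncard {i | r i = 1}.ncard
      {i | r i = 2}.ncard {i | r i = 3}.ncard := by
  classical
  have hfin : {i | r i < 4}.Finite := by
    have h1 := (hr 1 one_pos).tendsto_cofinite_zero.eventually_lt_const
      (show (0 : ℝ) < Real.exp (-(Real.pi * 1)) ^ 4 by positivity)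
    rw [Filter.eventually_cofinite] at h1
    refine h1.subset fun i hi => not_lt.2 (pow_le_pow_of_le_one (Real.exp_pos _).le ?_ (le_of_lt hi))
    rw [Real.exp_le_one_iff]
    linarith [Real.pi_pos]
  set S := hfin.toFinset
  have hS : ∀ i, i ∈ S ↔ r i < 4 := fun i => by simp [S]
  have hcard : ∀ j < 4, {i | r i = j}.ncard = {i ∈ S | r i = j}.card := fun j hj => by
    rw [← Set.ncard_coe_finset]
    congr 1
    ext i
    simp only [Set.mem_ofPred_eq, Finset.coe_filter, hS]
    omega
  refine ⟨fun τ => ∑' i : {i // i ∉ S}, thetaNome τ ^ (r i - 4), ?_, fun τ hτ => ?_⟩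
  · have hs : Summable fun i : {i // i ∉ S} => Real.exp (-(Real.pi * 1)) ^ (r i - 4) := by
      refine (((hr 1 one_pos).comp_injective (Subtype.val_injective (p := fun i => i ∉ S)))
        |>.div_const (Real.exp (-(Real.pi * 1)) ^ 4)).congr fun i => ?_
      have : 4 ≤ r i := not_lt.1 fun h => i.2 ((hS i).2 h)
      rw [div_eq_iff (by positivity), ← pow_add, Nat.sub_add_cancel this]
      rfl
    refine Asymptotics.IsBigO.of_bound (∑' i : {i // i ∉ S}, Real.exp (-(Real.pi * 1)) ^ (r i - 4))
      (Filter.eventually_principal.2 fun τ hτ => ?_)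
    rw [Pi.one_apply, norm_one, mul_one]
    refine tsum_of_norm_bounded hs.hasSum fun i => ?_
    rw [norm_pow, norm_thetaNome]
    refine pow_le_pow_left₀ (Real.exp_pos _).le (Real.exp_le_exp.2 ?_) _
    exact neg_le_neg (mul_le_mul_of_nonneg_left hτ Real.pi_pos.le)
  · have hsum := summable_thetaNome_pow (hr τ.im (by linarith))
    rw [thetaSeries, ← hsum.sum_add_tsum_subtype_compl S, ← tsum_mul_left]
    congr 1
    · rw [← Finset.sum_fiberwise_of_maps_to (t := Finset.range 4) (g := r)
        fun i hi => Finset.mem_range.2 ((hS i).1 hi)]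
      have : ∀ j ∈ Finset.range 4, ∑ i ∈ S with r i = j, thetaNome τ ^ r i =
          ({i | r i = j}.ncard : ℂ) * thetaNome τ ^ j := fun j hj => by
        rw [hcard j (Finset.mem_range.1 hj), ← nsmul_eq_mul, ← Finset.sum_const]
        exact Finset.sum_congr rfl fun i hi => by rw [(Finset.mem_filter.1 hi).2]
      rw [Finset.sum_congr rfl this]
      simp [Finset.sum_range_succ]
    · refine tsum_congr fun i => ?_
      have : 4 ≤ r i := not_lt.1 fun h => i.2 ((hS i).2 h)
      rw [← pow_add, Nat.add_sub_cancel' this]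

theorem differentiableOn_thetaSeries {ι : Type*} {r : ι → ℕ}
    (hr : ∀ y : ℝ, 0 < y → Summable fun i => Real.exp (-(Real.pi * y)) ^ r i) :
    DifferentiableOn ℂ (thetaSeries r) {z | 0 < z.im} := by
  intro τ hτ
  have hopen : IsOpen {z : ℂ | τ.im / 2 < z.im} := isOpen_lt continuous_const Complex.continuous_im
  have hmem : τ ∈ {z : ℂ | τ.im / 2 < z.im} := by
    have : 0 < τ.im := hτ
    change τ.im / 2 < τ.im
    linarith
  have hd : DifferentiableOn ℂ (thetaSeries r) {z | τ.im / 2 < z.im} := by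
    refine Complex.differentiableOn_tsum_of_summable_norm (hr (τ.im / 2) (half_pos hτ)) (fun i => ?_)
      hopen fun i z hz => ?_
    · unfold thetaNome
      fun_prop
    · rw [norm_pow, norm_thetaNome]
      refine pow_le_pow_left₀ (Real.exp_pos _).le (Real.exp_le_exp.2 ?_) _
      exact neg_le_neg (mul_le_mul_of_nonneg_left (le_of_lt hz) Real.pi_pos.le)
  exact (hd.differentiableAt (hopen.mem_nhds hmem)).differentiableWithinAt

theorem thetaSeries_add_two {ι : Type*} (r : ι → ℕ) (τ : ℂ) :
    thetaSeries r (τ + 1 + 1) = thetaSeries r τ := by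
  simp only [thetaSeries, thetaNome_add_one, neg_neg]

/-- Integral exponents give period 2, and the shadow is defined by the inversion law it has to
satisfy; only `hinv` carries content. -/
theorem isThetaTriple_thetaSeries {ι : Type*} {r : ι → ℕ} {n : ℕ}
    (hr : ∀ y : ℝ, 0 < y → Summable fun i => Real.exp (-(Real.pi * y)) ^ r i)
    (hinv : ∀ τ : ℂ, 0 < τ.im → thetaSeries r (-1 / τ) = thetaFactor τ ^ n * thetaSeries r τ) :
    IsThetaTriple n (thetaSeries r) (fun τ => thetaSeries r (τ + 1))
      fun τ => (thetaFactor τ ^ n)⁻¹ * thetaSeries r (-1 / τ + 1) where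
  differentiableOn_fst := differentiableOn_thetaSeries hr
  differentiableOn_snd := (differentiableOn_thetaSeries hr).comp (by fun_prop)
    fun τ hτ => by simpa using hτ
  differentiableOn_shadow := by
    refine DifferentiableOn.mul (DifferentiableOn.inv (DifferentiableOn.pow ?_ n)
      fun τ hτ => pow_ne_zero _ (thetaFactor_ne_zero hτ))
      ((differentiableOn_thetaSeries hr).comp ?_ fun τ hτ => ?_)
    · unfold thetaFactor
      exact DifferentiableOn.cpow_const (by fun_prop) fun τ hτ =>
        Complex.mem_slitPlane_iff.2 (Or.inl (by rw [neg_I_mul_re]; exact hτ))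
    · exact ((differentiableOn_const _).div differentiableOn_id
        fun τ hτ => ne_zero_of_im_pos hτ).add_const _
    · simpa using im_neg_one_div_pos hτ
  fst_add_one _ _ := rfl
  snd_add_one τ _ := thetaSeries_add_two r τ
  fst_inv := hinv
  snd_inv τ hτ := by rw [mul_inv_cancel_left₀ (pow_ne_zero _ (thetaFactor_ne_zero hτ))]

theorem exp_mul_I_ne_zero_of_summable {ι : Type*} [Nonempty ι] {r : ι → ℝ}
    (hr : Summable fun i => Real.exp (-Real.pi * r i)) :
    ∑' i, Complex.exp (Real.pi * Complex.I * (r i : ℂ) * Complex.I) ≠ 0 := by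
  have h1 : ∀ i, Complex.exp (Real.pi * Complex.I * (r i : ℂ) * Complex.I) =
      ((Real.exp (-Real.pi * r i) : ℝ) : ℂ) := fun i => by
    rw [Complex.ofReal_exp]
    congr 1
    push_cast
    linear_combination (Real.pi * r i : ℂ) * Complex.I_mul_I
  simp only [h1, ← Complex.ofReal_tsum]
  rw [Complex.ofReal_ne_zero]
  exact (hr.tsum_pos (fun i => (Real.exp_pos _).le) (Classical.arbitrary ι) (Real.exp_pos _)).ne'

/-! ### The theta functions θ₃, θ₄ and θ₂ of ℤ. -/

/-- The exponents of the theta series of `ℤ`. -/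
def intSqExponent (k : ℤ) : ℕ := (k ^ 2).natAbs

/-- The exponents of the theta series of the shadow of `ℤ`, shifted by `1 / 4`. -/
def intShadowExponent (k : ℤ) : ℕ := (k ^ 2 - k).natAbs

theorem intSqExponent_cast (k : ℤ) : ((intSqExponent k : ℝ) : ℂ) = (k : ℂ) ^ 2 := by
  have : ((intSqExponent k : ℤ)) = k ^ 2 := by
    rw [intSqExponent, Int.natCast_natAbs, abs_of_nonneg (sq_nonneg k)]
  have h : ((intSqExponent k : ℤ) : ℂ) = ((k ^ 2 : ℤ) : ℂ) := by rw [this]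
  push_cast at h ⊢
  exact h

theorem int_sq_sub_self_nonneg (k : ℤ) : 0 ≤ k ^ 2 - k := by
  rcases le_or_gt k 0 with h | h
  · nlinarith
  · nlinarith

theorem intShadowExponent_cast (k : ℤ) : ((intShadowExponent k : ℝ) : ℂ) = (k : ℂ) ^ 2 - k := by
  have : ((intShadowExponent k : ℤ)) = k ^ 2 - k := by
    rw [intShadowExponent, Int.natCast_natAbs, abs_of_nonneg (int_sq_sub_self_nonneg k)]
  have h : ((intShadowExponent k : ℤ) : ℂ) = ((k ^ 2 - k : ℤ) : ℂ) := by rw [this]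
  push_cast at h ⊢
  exact h

theorem even_intShadowExponent (k : ℤ) : Even (intShadowExponent k) := by
  rw [intShadowExponent, Int.natAbs_even, sq, ← mul_sub_one]
  exact Int.even_mul_pred_self k

theorem jacobiTheta₂_term_zero (k : ℤ) (τ : ℂ) :
    jacobiTheta₂_term k 0 τ = thetaNome τ ^ intSqExponent k := by
  rw [thetaNome_pow, intSqExponent_cast, jacobiTheta₂_term]
  congr 1
  ring

theorem jacobiTheta₂_term_neg_half (k : ℤ) (τ : ℂ) :
    jacobiTheta₂_term k (-τ / 2) τ = thetaNome τ ^ intShadowExponent k := by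
  rw [thetaNome_pow, intShadowExponent_cast, jacobiTheta₂_term]
  congr 1
  ring

theorem summable_intSqExponent (y : ℝ) (hy : 0 < y) :
    Summable fun k => Real.exp (-(Real.pi * y)) ^ intSqExponent k := by
  have h := ((summable_jacobiTheta₂_term_iff 0 (y * Complex.I)).2 (by simpa using hy)).norm
  refine h.congr fun k => ?_
  rw [jacobiTheta₂_term_zero, norm_pow, norm_thetaNome]
  simp

theorem summable_intShadowExponent (y : ℝ) (hy : 0 < y) :
    Summable fun k => Real.exp (-(Real.pi * y)) ^ intShadowExponent k := by
  have h := ((summable_jacobiTheta₂_term_iff (-(y * Complex.I) / 2)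
    (y * Complex.I)).2 (by simpa using hy)).norm
  refine h.congr fun k => ?_
  rw [jacobiTheta₂_term_neg_half, norm_pow, norm_thetaNome]
  simp

theorem thetaSeries_intSqExponent_inv (τ : ℂ) (hτ : 0 < τ.im) :
    thetaSeries intSqExponent (-1 / τ) = thetaFactor τ ^ 1 * thetaSeries intSqExponent τ := by
  have h := jacobiTheta₂_functional_equation 0 τ
  have h2 : ∀ σ, jacobiTheta₂ 0 σ = thetaSeries intSqExponent σ := fun σ =>
    tsum_congr fun k => jacobiTheta₂_term_zero k σ
  rw [zero_div, h2, h2] at h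
  rw [h, pow_one, ← thetaFactor]
  have := thetaFactor_ne_zero hτ
  field_simp
  simp

/-- The eighth root of the nome. -/
noncomputable def quarterNome (τ : ℂ) : ℂ := Complex.exp (Real.pi * Complex.I * τ / 4)

/-- Jacobi's functional equation at z = 1/2: since k² - k is even, the sign (-1)^k equals (-1)^(k²),
the effect of translating by 1. -/
theorem thetaSeries_intSqExponent_shadow (τ : ℂ) (hτ : 0 < τ.im) :
    (thetaFactor τ ^ 1)⁻¹ * thetaSeries intSqExponent (-1 / τ + 1) =
      quarterNome τ * thetaSeries intShadowExponent τ := by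
  have h0 := ne_zero_of_im_pos hτ
  have h := jacobiTheta₂_functional_equation (1 / 2) (-1 / τ)
  have h1 : jacobiTheta₂ (1 / 2) (-1 / τ) = thetaSeries intSqExponent (-1 / τ + 1) := by
    refine tsum_congr fun k => ?_
    rw [thetaNome_pow, intSqExponent_cast, jacobiTheta₂_term, Complex.exp_eq_exp_iff_exists_int]
    obtain ⟨e, he⟩ := Int.even_mul_pred_self k
    refine ⟨-e, ?_⟩
    have he' : (k : ℂ) ^ 2 - k = 2 * e := by
      have : ((k * (k - 1) : ℤ) : ℂ) = ((e + e : ℤ) : ℂ) := by rw [he]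
      push_cast at this
      linear_combination this
    push_cast
    linear_combination -(Real.pi * Complex.I) * he'
  have h2 : jacobiTheta₂ (-τ / 2) τ = thetaSeries intShadowExponent τ :=
    tsum_congr fun k => jacobiTheta₂_term_neg_half k τ
  rw [show -1 / (-1 / τ) = τ by field_simp, show 1 / 2 / (-1 / τ) = -τ / 2 by field_simp, h1,
    h2, ← thetaFactor] at h
  rw [h, pow_one, quarterNome, one_div,
    ← eq_inv_of_mul_eq_one_left (thetaFactor_mul_thetaFactor_neg_one_div hτ),
    mul_assoc, inv_mul_cancel_left₀ (thetaFactor_ne_zero hτ)]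
  congr 2
  field_simp
  ring

theorem isThetaTriple_int : IsThetaTriple 1 (thetaSeries intSqExponent)
    (fun τ => thetaSeries intSqExponent (τ + 1))
    fun τ => (thetaFactor τ ^ 1)⁻¹ * thetaSeries intSqExponent (-1 / τ + 1) :=
  isThetaTriple_thetaSeries summable_intSqExponent thetaSeries_intSqExponent_inv

theorem ncard_intSqExponent_eq : {k | intSqExponent k = 0}.ncard = 1 ∧
    {k | intSqExponent k = 1}.ncard = 2 ∧ {k | intSqExponent k = 2}.ncard = 0 ∧
    {k | intSqExponent k = 3}.ncard = 0 := by
  have hb : ∀ k j, intSqExponent k = j → j < 4 → -2 < k ∧ k < 2 := fun k j hk hj => by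
    rw [intSqExponent] at hk
    have : k ^ 2 < 4 := by have := sq_nonneg k; omega
    constructor <;> nlinarith
  refine ⟨?_, ?_, ?_, ?_⟩
  · rw [show {k | intSqExponent k = 0} = {0} by ext; simp [intSqExponent], Set.ncard_singleton]
  · rw [show {k | intSqExponent k = 1} = {1, -1} by
      ext k
      simp only [Set.mem_ofPred_eq, Set.mem_insert_iff, Set.mem_singleton_iff]
      refine ⟨fun h => ?_, fun h => by rcases h with rfl | rfl <;> decide⟩
      obtain ⟨h1, h2⟩ := hb k _ h (by norm_num)
      interval_cases k <;> simp_all [intSqExponent], Set.ncard_pair (by decide)]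
  · rw [show {k | intSqExponent k = 2} = ∅ from Set.eq_empty_of_forall_notMem fun k h => by
      obtain ⟨h1, h2⟩ := hb k _ h (by norm_num)
      interval_cases k <;> simp [intSqExponent] at h, Set.ncard_empty]
  · rw [show {k | intSqExponent k = 3} = ∅ from Set.eq_empty_of_forall_notMem fun k h => by
      obtain ⟨h1, h2⟩ := hb k _ h (by norm_num)
      interval_cases k <;> simp [intSqExponent] at h, Set.ncard_empty]

theorem ncard_intShadowExponent_eq : {k | intShadowExponent k = 0}.ncard = 2 ∧
    {k | intShadowExponent k = 1}.ncard = 0 ∧ {k | intShadowExponent k = 2}.ncard = 2 ∧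
    {k | intShadowExponent k = 3}.ncard = 0 := by
  have hb : ∀ k j, intShadowExponent k = j → j < 4 → -2 < k ∧ k < 3 := fun k j hk hj => by
    rw [intShadowExponent] at hk
    have : k ^ 2 - k < 4 := by have := int_sq_sub_self_nonneg k; omega
    constructor <;> nlinarith
  refine ⟨?_, ?_, ?_, ?_⟩
  · rw [show {k | intShadowExponent k = 0} = {0, 1} by
      ext k
      simp only [Set.mem_ofPred_eq, Set.mem_insert_iff, Set.mem_singleton_iff]
      refine ⟨fun h => ?_, fun h => by rcases h with rfl | rfl <;> decide⟩
      obtain ⟨h1, h2⟩ := hb k _ h (by norm_num)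
      interval_cases k <;> simp_all [intShadowExponent], Set.ncard_pair (by decide)]
  · rw [show {k | intShadowExponent k = 1} = ∅ from Set.eq_empty_of_forall_notMem fun k h => by
      obtain ⟨h1, h2⟩ := hb k _ h (by norm_num)
      interval_cases k <;> simp [intShadowExponent] at h, Set.ncard_empty]
  · rw [show {k | intShadowExponent k = 2} = {-1, 2} by
      ext k
      simp only [Set.mem_ofPred_eq, Set.mem_insert_iff, Set.mem_singleton_iff]
      refine ⟨fun h => ?_, fun h => by rcases h with rfl | rfl <;> decide⟩
      obtain ⟨h1, h2⟩ := hb k _ h (by norm_num)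
      interval_cases k <;> simp_all [intShadowExponent], Set.ncard_pair (by decide)]
  · rw [show {k | intShadowExponent k = 3} = ∅ from Set.eq_empty_of_forall_notMem fun k h => by
      obtain ⟨h1, h2⟩ := hb k _ h (by norm_num)
      interval_cases k <;> simp [intShadowExponent] at h, Set.ncard_empty]

theorem hasThetaExpansion_int : HasThetaExpansion (thetaSeries intSqExponent) 1 2 0 0 := by
  obtain ⟨h0, h1, h2, h3⟩ := ncard_intSqExponent_eq
  have h := hasThetaExpansion_thetaSeries summable_intSqExponent
  rw [h0, h1, h2, h3] at h
  exact h.congr (by simp) (by simp) (by simp) (by simp)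

theorem hasThetaExpansion_intShadow :
    HasThetaExpansion (thetaSeries intShadowExponent) 2 0 2 0 := by
  obtain ⟨h0, h1, h2, h3⟩ := ncard_intShadowExponent_eq
  have h := hasThetaExpansion_thetaSeries summable_intShadowExponent
  rw [h0, h1, h2, h3] at h
  exact h.congr (by simp) (by simp) (by simp) (by simp)

theorem quarterNome_add_one (τ : ℂ) :
    quarterNome (τ + 1) = quarterNome τ * Complex.exp (Real.pi * Complex.I / 4) := by
  rw [quarterNome, quarterNome, ← Complex.exp_add]
  congr 1
  ring

/-- The fourth power leaves four candidates. The shadow of ℤ is q^(1/4) times a series in q² that is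
nonzero at i, and this selects the right one. -/
theorem shadowFactor_I : shadowFactor Complex.I = Complex.exp (Real.pi * Complex.I / 4) := by
  have hI : 0 < Complex.I.im := by simp
  have h := isThetaTriple_int.shadow_add_one Complex.I hI
  rw [thetaSeries_intSqExponent_shadow _ (by simp), thetaSeries_intSqExponent_shadow _ hI,
    quarterNome_add_one, pow_one] at h
  have h1 : thetaSeries intShadowExponent (Complex.I + 1) =
      thetaSeries intShadowExponent Complex.I :=
    tsum_congr fun k => by rw [thetaNome_add_one, (even_intShadowExponent k).neg_pow]
  have h2 : thetaSeries intShadowExponent Complex.I ≠ 0 := by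
    simp only [thetaSeries, thetaNome_pow]
    refine exp_mul_I_ne_zero_of_summable ((summable_intShadowExponent 1 one_pos).congr fun k => ?_)
    rw [← Real.exp_nat_mul]
    congr 1
    ring
  have h3 : quarterNome Complex.I ≠ 0 := Complex.exp_ne_zero _
  rw [h1] at h
  refine mul_right_cancel₀ (mul_ne_zero h3 h2) (h.symm.trans ?_)
  ring

/-! ### Theta series and shadow of a unimodular lattice. -/

/-- The exponents of the theta series of an integral lattice. -/
noncomputable def latticeExponent {n : ℕ} (Λ : Submodule ℤ (EuclideanSpace ℝ (Fin n))) (x : Λ) :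
    ℕ := ⌊‖(x : EuclideanSpace ℝ (Fin n))‖ ^ 2⌋₊

theorem IsCharacteristicVector.add_two_smul {n : ℕ} {Λ : Submodule ℤ (EuclideanSpace ℝ (Fin n))}
    (hΛ : IsUnimodularLattice Λ) {w : EuclideanSpace ℝ (Fin n)} (hw : IsCharacteristicVector Λ w)
    {x : EuclideanSpace ℝ (Fin n)} (hx : x ∈ Λ) :
    IsCharacteristicVector Λ (w + (2 : ℝ) • x) := by
  refine ⟨Λ.add_mem hw.1 ?_, fun v hv => ?_⟩
  · rw [two_smul]
    exact Λ.add_mem hx hx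
  · obtain ⟨k, hk⟩ := hw.2 v hv
    obtain ⟨l, hl⟩ := hΛ.integral x hx v hv
    refine ⟨k + l, ?_⟩
    rw [inner_add_left, real_inner_smul_left, hl]
    push_cast
    linear_combination hk

namespace IsUnimodularLattice

variable {n : ℕ} {Λ : Submodule ℤ (EuclideanSpace ℝ (Fin n))}

theorem cast_latticeExponent (h : IsUnimodularLattice Λ) (x : Λ) :
    (latticeExponent Λ x : ℝ) = ‖(x : EuclideanSpace ℝ (Fin n))‖ ^ 2 := by
  obtain ⟨k, hk⟩ := h.integral x x.2 x x.2
  rw [real_inner_self_eq_norm_sq] at hk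
  have h0 : 0 ≤ k := by
    have : (0 : ℝ) ≤ k := hk ▸ sq_nonneg _
    exact_mod_cast this
  lift k to ℕ using h0
  rw [latticeExponent, hk, Int.cast_natCast, Nat.floor_natCast]

theorem summable_latticeExponent (h : IsUnimodularLattice Λ) (y : ℝ) (hy : 0 < y) :
    Summable fun x => Real.exp (-(Real.pi * y)) ^ latticeExponent Λ x := by
  refine (h.summable_exp_neg_mul_norm_sq (mul_pos Real.pi_pos hy)).congr fun x => ?_
  rw [← Real.exp_nat_mul, h.cast_latticeExponent, mul_comm]

theorem thetaSeries_inv (h : IsUnimodularLattice Λ) (τ : ℂ) (hτ : 0 < τ.im) :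
    thetaSeries (latticeExponent Λ) (-1 / τ) =
      thetaFactor τ ^ n * thetaSeries (latticeExponent Λ) τ := by
  have h1 := h.tsum_translate_inversion 0 hτ
  simp only [thetaSeries, thetaNome_pow, h.cast_latticeExponent]
  simpa using h1

theorem isThetaTriple (h : IsUnimodularLattice Λ) : IsThetaTriple n
    (thetaSeries (latticeExponent Λ)) (fun τ => thetaSeries (latticeExponent Λ) (τ + 1))
    fun τ => (thetaFactor τ ^ n)⁻¹ * thetaSeries (latticeExponent Λ) (-1 / τ + 1) :=
  isThetaTriple_thetaSeries h.summable_latticeExponent h.thetaSeries_inv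

/-- In the inversion formula translated by w/2 the character is exp(πi(x, w)). As `w` is
characteristic this equals exp(πi‖x‖²), the effect of τ ↦ τ + 1. -/
theorem thetaSeries_shadow (h : IsUnimodularLattice Λ) {w : EuclideanSpace ℝ (Fin n)}
    (hw : IsCharacteristicVector Λ w) (τ : ℂ) (hτ : 0 < τ.im) :
    (thetaFactor τ ^ n)⁻¹ * thetaSeries (latticeExponent Λ) (-1 / τ + 1) =
      ∑' x : Λ, Complex.exp (Real.pi * Complex.I *
        ((‖(x : EuclideanSpace ℝ (Fin n)) + (1 / 2 : ℝ) • w‖ ^ 2 : ℝ) : ℂ) * τ) := by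
  rw [inv_mul_eq_iff_eq_mul₀ (pow_ne_zero _ (thetaFactor_ne_zero hτ)),
    ← h.tsum_translate_inversion _ hτ]
  refine tsum_congr fun x => ?_
  rw [thetaNome_pow, h.cast_latticeExponent, ← Complex.exp_add, Complex.exp_eq_exp_iff_exists_int]
  obtain ⟨k, hk⟩ := hw.2 x x.2
  refine ⟨-k, ?_⟩
  rw [real_inner_smul_right, real_inner_comm]
  rw [real_inner_self_eq_norm_sq] at hk
  have hk' : (inner ℝ w (x : EuclideanSpace ℝ (Fin n)) : ℂ) -
      (‖(x : EuclideanSpace ℝ (Fin n))‖ ^ 2 : ℝ) = 2 * k := by exact_mod_cast hk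
  push_cast at hk' ⊢
  linear_combination -(Real.pi * Complex.I) * hk'

theorem exists_norm_sq_add_half_smul (h : IsUnimodularLattice Λ) {w : EuclideanSpace ℝ (Fin n)}
    (hw : IsCharacteristicVector Λ w) (x : Λ) : ∃ k : ℤ,
      ‖(x : EuclideanSpace ℝ (Fin n)) + (1 / 2 : ℝ) • w‖ ^ 2 = ‖w‖ ^ 2 / 4 + 2 * k := by
  obtain ⟨k, hk⟩ := hw.2 x x.2
  obtain ⟨l, hl⟩ := h.integral x x.2 x x.2
  refine ⟨k + l, ?_⟩
  rw [norm_add_sq_real, norm_smul, real_inner_smul_right, real_inner_comm,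
    ← real_inner_self_eq_norm_sq (x : EuclideanSpace ℝ (Fin n))]
  rw [hl] at hk ⊢
  rw [Real.norm_of_nonneg (by norm_num)]
  push_cast
  linear_combination hk

/-- The norm of a characteristic vector is congruent to the dimension modulo `8`. -/
theorem exists_norm_sq_eq_add_eight_mul (h : IsUnimodularLattice Λ)
    {w : EuclideanSpace ℝ (Fin n)} (hw : IsCharacteristicVector Λ w) :
    ∃ j : ℤ, ‖w‖ ^ 2 = n + 8 * j := by
  have hI : 0 < Complex.I.im := by simp
  -- At τ = i the shadow series is a positive number. Translation by 1 multiplies it by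
  -- exp(πi‖w‖²/4) termwise and by exp(πin/4) by the triple law.
  have h1 := h.isThetaTriple.shadow_add_one Complex.I hI
  rw [h.thetaSeries_shadow hw _ (by simp), h.thetaSeries_shadow hw _ hI, shadowFactor_I,
    ← Complex.exp_nat_mul] at h1
  have h2 : ∀ x : Λ, Complex.exp (Real.pi * Complex.I *
      ((‖(x : EuclideanSpace ℝ (Fin n)) + (1 / 2 : ℝ) • w‖ ^ 2 : ℝ) : ℂ) * (Complex.I + 1)) =
      Complex.exp (Real.pi * Complex.I * (‖w‖ ^ 2 / 4 : ℝ)) * Complex.exp (Real.pi * Complex.I *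
      ((‖(x : EuclideanSpace ℝ (Fin n)) + (1 / 2 : ℝ) • w‖ ^ 2 : ℝ) : ℂ) * Complex.I) := by
    intro x
    obtain ⟨k, hk⟩ := h.exists_norm_sq_add_half_smul hw x
    rw [← Complex.exp_add, Complex.exp_eq_exp_iff_exists_int]
    refine ⟨k, ?_⟩
    rw [hk]
    push_cast
    ring
  simp only [h2, tsum_mul_left] at h1
  have h3 := mul_right_cancel₀ (exp_mul_I_ne_zero_of_summable
    (h.summable_theta_translate Real.pi_pos ((1 / 2 : ℝ) • w))) h1
  rw [Complex.exp_eq_exp_iff_exists_int] at h3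
  obtain ⟨j, hj⟩ := h3
  refine ⟨j, ?_⟩
  have hpi : (Real.pi * Complex.I : ℂ) ≠ 0 :=
    mul_ne_zero (by exact_mod_cast Real.pi_ne_zero) Complex.I_ne_zero
  have h4 : ((‖w‖ ^ 2 / 4 : ℝ) : ℂ) = n / 4 + 2 * j :=
    mul_left_cancel₀ hpi (by rw [hj]; ring)
  have h5 : ‖w‖ ^ 2 / 4 = n / 4 + 2 * j :=
    Complex.ofReal_injective (by rw [h4]; push_cast; rfl)
  linarith

end IsUnimodularLattice

theorem quarterNome_pow_four (τ : ℂ) : quarterNome τ ^ 4 = thetaNome τ := by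
  rw [quarterNome, thetaNome, ← Complex.exp_nat_mul]
  congr 1
  push_cast
  ring

theorem quarterNome_ne_zero (τ : ℂ) : quarterNome τ ≠ 0 := Complex.exp_ne_zero _

theorem norm_quarterNome (τ : ℂ) : ‖quarterNome τ‖ = Real.exp (-(1 / 4 * Real.pi * τ.im)) := by
  have := norm_cexp_pi_mul_I_mul 1 (τ / 4)
  rw [Complex.ofReal_one, mul_one, mul_one, ← mul_div_assoc] at this
  rw [quarterNome, this]
  congr 1
  simp
  ring

/-! ### The shadow of an n - 24 lattice and the upper bound for N₂. -/

namespace IsNSubEightMulLattice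

variable {m : ℕ} {Λ : Submodule ℤ (EuclideanSpace ℝ (Fin (m + 24)))}

/-- The vector w + 2x = 2(x + w/2) is characteristic, of norm n + 8j with j ≥ -3, so the exponent is
2(j + 3). The values 0 and 2 correspond to norms n - 24 and n - 16. -/
theorem exists_shadowExponent (h : IsNSubEightMulLattice 3 Λ)
    {w : EuclideanSpace ℝ (Fin (m + 24))} (hw : IsCharacteristicVector Λ w) :
    ∃ s : Λ → ℕ, ∀ x : Λ,
      ‖(x : EuclideanSpace ℝ (Fin (m + 24))) + (1 / 2 : ℝ) • w‖ ^ 2 = m / 4 + s x := by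
  have key : ∀ x : Λ, ∃ s : ℕ,
      ‖(x : EuclideanSpace ℝ (Fin (m + 24))) + (1 / 2 : ℝ) • w‖ ^ 2 = m / 4 + s := by
    intro x
    have hc := hw.add_two_smul h.1 x.2
    obtain ⟨j, hj⟩ := h.1.exists_norm_sq_eq_add_eight_mul hc
    have h1 := h.2 _ hc
    have h2 : ‖w + (2 : ℝ) • (x : EuclideanSpace ℝ (Fin (m + 24)))‖ ^ 2 =
        4 * ‖(x : EuclideanSpace ℝ (Fin (m + 24))) + (1 / 2 : ℝ) • w‖ ^ 2 := by
      rw [show w + (2 : ℝ) • (x : EuclideanSpace ℝ (Fin (m + 24))) =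
        (2 : ℝ) • ((x : EuclideanSpace ℝ (Fin (m + 24))) + (1 / 2 : ℝ) • w) by
          rw [smul_add, smul_smul]; norm_num [add_comm], norm_smul, mul_pow]
      norm_num
    rw [hj] at h1
    have h3 : 0 ≤ j + 3 := by
      have : (0 : ℝ) ≤ (j : ℝ) + 3 := by push_cast at h1; linarith
      exact_mod_cast this
    obtain ⟨t, ht⟩ := Int.eq_ofNat_of_zero_le h3
    have ht' : (j : ℝ) + 3 = t := by exact_mod_cast ht
    refine ⟨2 * t, ?_⟩
    rw [hj] at h2
    push_cast at h2 ⊢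
    linarith
  exact ⟨_, fun x => (key x).choose_spec⟩

theorem summable_shadowExponent (h : IsNSubEightMulLattice 3 Λ)
    {w : EuclideanSpace ℝ (Fin (m + 24))} {s : Λ → ℕ}
    (hs : ∀ x : Λ, ‖(x : EuclideanSpace ℝ (Fin (m + 24))) + (1 / 2 : ℝ) • w‖ ^ 2 = m / 4 + s x)
    (y : ℝ) (hy : 0 < y) : Summable fun x => Real.exp (-(Real.pi * y)) ^ s x := by
  refine ((h.1.summable_theta_translate (mul_pos Real.pi_pos hy) ((1 / 2 : ℝ) • w)).mul_left
    (Real.exp (Real.pi * y * (m / 4)))).congr fun x => ?_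
  rw [← Real.exp_nat_mul, hs, ← Real.exp_add]
  congr 1
  ring

theorem thetaSeries_shadow (h : IsNSubEightMulLattice 3 Λ)
    {w : EuclideanSpace ℝ (Fin (m + 24))} (hw : IsCharacteristicVector Λ w) {s : Λ → ℕ}
    (hs : ∀ x : Λ, ‖(x : EuclideanSpace ℝ (Fin (m + 24))) + (1 / 2 : ℝ) • w‖ ^ 2 = m / 4 + s x)
    (τ : ℂ) (hτ : 0 < τ.im) :
    (thetaFactor τ ^ (m + 24))⁻¹ * thetaSeries (latticeExponent Λ) (-1 / τ + 1) =
      quarterNome τ ^ m * thetaSeries s τ := by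
  rw [h.1.thetaSeries_shadow hw τ hτ, thetaSeries, ← tsum_mul_left]
  refine tsum_congr fun x => ?_
  rw [hs, thetaNome_pow, quarterNome, ← Complex.exp_nat_mul, ← Complex.exp_add]
  congr 1
  push_cast
  ring

/-- In a lattice without roots, the characteristic vectors of norm `n - 16` are incongruent
modulo `4Λ`. -/
theorem ncard_shadowExponent_eq_two_le (h : IsNSubEightMulLattice 3 Λ) (hroot : HasNoRoots Λ)
    {w : EuclideanSpace ℝ (Fin (m + 24))} (hw : IsCharacteristicVector Λ w) {s : Λ → ℕ}
    (hs : ∀ x : Λ, ‖(x : EuclideanSpace ℝ (Fin (m + 24))) + (1 / 2 : ℝ) • w‖ ^ 2 = m / 4 + s x) :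
    {x | s x = 2}.ncard ≤ 2 ^ (m + 24) := by
  obtain ⟨b⟩ := h.1.nonempty_basis
  have hcard : (Set.univ : Set (Fin (m + 24) → ZMod 2)).ncard = 2 ^ (m + 24) := by
    rw [Set.ncard_univ, Nat.card_eq_fintype_card, Fintype.card_fun, ZMod.card, Fintype.card_fin]
  rw [← hcard]
  refine Set.ncard_le_ncard_of_injOn (fun x i => (b.repr x i : ZMod 2)) (fun _ _ => trivial)
    (fun x hx y hy hxy => ?_) Set.finite_univ
  have hmod : ∀ i, ∃ k : ℤ, b.repr x i - b.repr y i = 2 * k := fun i => by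
    have := congrFun hxy i
    dsimp only at this
    obtain ⟨k, hk⟩ := (ZMod.intCast_eq_intCast_iff_dvd_sub _ _ 2).1 this.symm
    exact ⟨k, by exact_mod_cast hk⟩
  choose k hk using hmod
  set v : Λ := ∑ i, k i • b i
  have hxv : x = y + (2 : ℤ) • v := by
    refine b.repr.injective (Finsupp.ext fun i => ?_)
    rw [map_add, map_smul, Finsupp.add_apply, Finsupp.smul_apply, b.repr_sum_self, smul_eq_mul,
      ← hk]
    ring
  have hxv' : (x : EuclideanSpace ℝ (Fin (m + 24))) =
      (y : EuclideanSpace ℝ (Fin (m + 24))) + (2 : ℝ) • (v : EuclideanSpace ℝ (Fin (m + 24))) := by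
    rw [hxv, Submodule.coe_add, Submodule.coe_smul, ← Int.cast_smul_eq_zsmul ℝ]
    norm_num
  -- The midpoint w + 2(y + v) of w + 2x and w + 2y is characteristic, so its norm is at least n -
  -- 24; the parallelogram law then leaves ‖v‖² ≤ 2.
  have hu := h.2 _ (hw.add_two_smul h.1 (y + v).2)
  rw [Submodule.coe_add] at hu
  have hsx := hs x
  have hsy := hs y
  rw [show s x = 2 from hx] at hsx
  rw [show s y = 2 from hy] at hsy
  set X := (y : EuclideanSpace ℝ (Fin (m + 24))) + (1 / 2 : ℝ) • w
  set V := (v : EuclideanSpace ℝ (Fin (m + 24))) with hV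
  rw [show w + (2 : ℝ) • ((y : EuclideanSpace ℝ (Fin (m + 24))) + V) = (2 : ℝ) • (X + V) by
    simp only [X]; module, norm_smul, mul_pow, Real.norm_of_nonneg zero_le_two] at hu
  rw [show (x : EuclideanSpace ℝ (Fin (m + 24))) + (1 / 2 : ℝ) • w = X + V + V by
    simp only [X, hxv']; module] at hsx
  have hp := parallelogram_law_with_norm ℝ (X + V) V
  rw [add_sub_cancel_right, hsx, hsy] at hp
  have hV2 : ‖V‖ ^ 2 ≤ 2 := by
    push_cast at hu hp
    linarith
  have hr := h.1.cast_latticeExponent v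
  rw [← hV] at hr
  have hv := hroot V v.2
  rw [← hr] at hV2 hv
  have hle : latticeExponent Λ v ≤ 2 := by exact_mod_cast hV2
  have h1 : latticeExponent Λ v ≠ 1 := by exact_mod_cast hv.1
  have h2 : latticeExponent Λ v ≠ 2 := by exact_mod_cast hv.2
  have h0 : latticeExponent Λ v = 0 := by omega
  rw [h0, Nat.cast_zero, eq_comm, sq_eq_zero_iff, norm_eq_zero] at hr
  rw [hr, smul_zero, add_zero] at hxv'
  exact Subtype.ext hxv'

end IsNSubEightMulLattice

/-- A lattice without roots has theta series `1 + O(q³)`. -/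
theorem IsUnimodularLattice.hasThetaExpansion {n : ℕ}
    {Λ : Submodule ℤ (EuclideanSpace ℝ (Fin n))} (h : IsUnimodularLattice Λ)
    (hroot : HasNoRoots Λ) : ∃ c, HasThetaExpansion (thetaSeries (latticeExponent Λ)) 1 0 0 c := by
  have h0 : {x | latticeExponent Λ x = 0} = {0} := by
    ext x
    simp only [Set.mem_ofPred_eq, Set.mem_singleton_iff]
    rw [← Nat.cast_inj (R := ℝ), h.cast_latticeExponent, Nat.cast_zero, sq_eq_zero_iff,
      norm_eq_zero, ZeroMemClass.coe_eq_zero]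
  have h1 : {x | latticeExponent Λ x = 1} = ∅ := Set.eq_empty_of_forall_notMem fun x hx => by
    refine (hroot x x.2).1 ?_
    rw [← h.cast_latticeExponent, show latticeExponent Λ x = 1 from hx, Nat.cast_one]
  have h2 : {x | latticeExponent Λ x = 2} = ∅ := Set.eq_empty_of_forall_notMem fun x hx => by
    refine (hroot x x.2).2 ?_
    rw [← h.cast_latticeExponent, show latticeExponent Λ x = 2 from hx, Nat.cast_ofNat]
  have := hasThetaExpansion_thetaSeries h.summable_latticeExponent
  rw [h0, h1, h2] at this
  exact ⟨_, this.congr (by simp) (by simp) (by simp) rfl⟩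

/-! ### Expansions of the combination and of its shadow. -/

theorem hasThetaExpansion_delta : HasThetaExpansion
    (fun τ => (quarterNome τ * thetaSeries intShadowExponent τ) ^ 4 *
      thetaSeries intSqExponent (τ + 1) ^ 4) 0 16 (-128) 448 := by
  have hT := hasThetaExpansion_intShadow
  have hg := hasThetaExpansion_int.comp_add_one
  have hT4 := (hT.mul hT).mul (hT.mul hT)
  have hg4 := (hg.mul hg).mul (hg.mul hg)
  have := hT4.thetaNome_mul.mul hg4
  convert! this using 1
  · ext τ
    simp only [Pi.mul_apply]
    rw [← quarterNome_pow_four]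
    ring
  all_goals norm_num

theorem hasThetaExpansion_deltaShadow : HasThetaExpansion
    (-(thetaSeries intSqExponent ^ 4 * (fun τ => thetaSeries intSqExponent (τ + 1)) ^ 4))
    (-1) 0 16 0 := by
  have hf := hasThetaExpansion_int
  have h1 := hf.mul hf.comp_add_one
  have := ((h1.mul h1).mul (h1.mul h1)).smul (-1)
  convert! this using 1
  · ext τ
    simp only [Pi.mul_apply, Pi.smul_apply, Pi.neg_apply, Pi.pow_apply, smul_eq_mul]
    ring
  all_goals norm_num

theorem hasThetaExpansion_intShadow_pow (k : ℕ) : ∃ c,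
    HasThetaExpansion (thetaSeries intShadowExponent ^ k) (2 ^ k) 0 (2 ^ k * k) c := by
  have h1 : HasThetaExpansion ((1 / 2 : ℂ) • thetaSeries intShadowExponent) 1 0 1 0 :=
    (hasThetaExpansion_intShadow.smul (1 / 2)).congr (by norm_num) (by norm_num) (by norm_num)
      (by norm_num)
  obtain ⟨c, hc⟩ := h1.pow k
  refine ⟨2 ^ k * c, ?_⟩
  have h2 := hc.smul (2 ^ k)
  rw [smul_pow, smul_smul, ← mul_pow, mul_one_div_cancel two_ne_zero, one_pow, one_smul] at h2
  exact h2.congr (by ring) (by ring) (by ring) rfl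

theorem HasThetaExpansion.thetaNome_pow_four_mul {f : ℂ → ℂ}
    (hf : f =O[cuspFilter] (1 : ℂ → ℝ)) : HasThetaExpansion (thetaNome ^ 4 * f) 0 0 0 0 :=
  ⟨f, hf, fun τ _ => by simp⟩

/-- The combination `-tⁿ + n/8 tⁿ⁻⁸d - n(n-23)/128 tⁿ⁻¹⁶d² + c tⁿ⁻²⁴d³`, where `n = m + 24`. -/
noncomputable def thetaCombination (m : ℕ) (c : ℂ) (t d : ℂ → ℂ) : ℂ → ℂ :=
  (-1 : ℂ) • t ^ (m + 24) + ((m + 24) / 8 : ℂ) • (t ^ (m + 16) * d) +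
  (-((m + 24) * (m + 1)) / 128 : ℂ) • (t ^ (m + 8) * d ^ 2) + c • (t ^ m * d ^ 3)

theorem IsThetaTriple.thetaCombination {f g h : ℂ → ℂ} (H : IsThetaTriple 1 f g h) (m : ℕ) (c : ℂ) :
    IsThetaTriple (m + 24) (thetaCombination m c f (h ^ 4 * g ^ 4))
      (thetaCombination m c g (-(h ^ 4 * f ^ 4))) (thetaCombination m c h (-(f ^ 4 * g ^ 4))) := by
  have hdim : ∀ {k : ℕ} {f g e : ℂ → ℂ}, IsThetaTriple k f g e → k = m + 24 →
      IsThetaTriple (m + 24) f g e := fun H hk => hk ▸ H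
  have H0 := hdim (H.pow (m + 24)) (by ring)
  have H1 := hdim ((H.pow (m + 16)).mul H.delta) (by ring)
  have H2 := hdim ((H.pow (m + 8)).mul (H.delta.pow 2)) (by ring)
  have H3 := hdim ((H.pow m).mul (H.delta.pow 3)) (by ring)
  exact ((((H0.smul (-1)).add (H1.smul ((m + 24) / 8 : ℂ))).add
    (H2.smul (-((m + 24) * (m + 1)) / 128 : ℂ)))).add (H3.smul c)

/-- The fixed coefficients of `thetaCombination` are forced in turn by cancelling q⁰, q¹ and q². As
d³ = 4096 q³ + ⋯, the constant `c` can then cancel q³. -/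
theorem exists_hasThetaExpansion_add_thetaCombination {f t d : ℂ → ℂ} {a : ℂ}
    (hf : HasThetaExpansion f 1 0 0 a) (ht : HasThetaExpansion t 1 2 0 0)
    (hd : HasThetaExpansion d 0 16 (-128) 448) (m : ℕ) :
    ∃ c, HasThetaExpansion (f + thetaCombination m c t d) 0 0 0 0 := by
  obtain ⟨c0, E0⟩ := ht.pow (m + 24)
  obtain ⟨c1, E1⟩ := ht.pow (m + 16)
  obtain ⟨c2, E2⟩ := ht.pow (m + 8)
  obtain ⟨c3, E3⟩ := ht.pow m
  have hd2 := hd.mul hd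
  have hd3 := hd2.mul hd
  rw [← sq] at hd2
  rw [← sq, ← pow_succ] at hd3
  obtain ⟨K, hK⟩ : ∃ K : ℂ, HasThetaExpansion _ 0 0 0 K :=
    ⟨_, (hf.add (((E0.smul (-1)).add ((E1.mul hd).smul ((m + 24) / 8 : ℂ))).add
      ((E2.mul hd2).smul (-((m + 24) * (m + 1)) / 128 : ℂ)))).congr (by ring)
      (by push_cast; ring) (by push_cast; ring) rfl⟩
  refine ⟨-K / 4096, ?_⟩
  have := hK.add ((E3.mul hd3).smul (-K / 4096))
  rw [add_assoc] at this
  exact this.congr (by ring) (by ring) (by ring) (by ring)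

/-- The shadow of `thetaCombination` at `θ₃` and `(θ₂θ₄)⁴`, divided by `q ^ (m / 4)`. -/
noncomputable def shadowCombination (m : ℕ) (c : ℂ) (t d : ℂ → ℂ) : ℂ → ℂ :=
  (-1 : ℂ) • (thetaNome ^ 4 * (thetaNome * (thetaNome * t ^ (m + 24)))) +
  ((m + 24) / 8 : ℂ) • (thetaNome ^ 4 * (t ^ (m + 16) * d)) +
  (-((m + 24) * (m + 1)) / 128 : ℂ) • (thetaNome * (thetaNome * (t ^ (m + 8) * d ^ 2))) +
  c • (t ^ m * d ^ 3)

theorem thetaCombination_apply_eq (m : ℕ) (c : ℂ) {u t d : ℂ → ℂ} {τ : ℂ}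
    (hu : u τ = quarterNome τ * t τ) : thetaCombination m c u d τ =
      quarterNome τ ^ m * shadowCombination m c t d τ := by
  simp only [thetaCombination, shadowCombination, Pi.add_apply, Pi.smul_apply, Pi.mul_apply,
    Pi.pow_apply, smul_eq_mul]
  rw [hu, ← quarterNome_pow_four]
  ring

/-- After removal of q^(m/4), the power θ₂^(m+24-8r) contributes q^(6-2r): the terms r = 0, 1 start
at q⁴ or later, r = 2 at q², r = 3 at q⁰. The 48 = 3 · 16 is the q² coefficient of d³. -/
theorem hasThetaExpansion_shadowCombination (m : ℕ) (c : ℂ) {d : ℂ → ℂ}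
    (hd : HasThetaExpansion d (-1) 0 16 0) : ∃ K,
    HasThetaExpansion (shadowCombination m c (thetaSeries intShadowExponent) d) (-(c * 2 ^ m)) 0
      (-(2 ^ (m + 1) * (m + 24) * (m + 1)) + c * 2 ^ m * (48 - m)) K := by
  obtain ⟨c0, E0⟩ := hasThetaExpansion_intShadow_pow (m + 24)
  obtain ⟨c1, E1⟩ := hasThetaExpansion_intShadow_pow (m + 16)
  obtain ⟨c2, E2⟩ := hasThetaExpansion_intShadow_pow (m + 8)
  obtain ⟨c3, E3⟩ := hasThetaExpansion_intShadow_pow m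
  have hd2 := hd.mul hd
  have hd3 := hd2.mul hd
  rw [← sq] at hd2
  rw [← sq, ← pow_succ] at hd3
  have F0 := HasThetaExpansion.thetaNome_pow_four_mul E0.thetaNome_mul.thetaNome_mul.isBigO_one
  have F1 := HasThetaExpansion.thetaNome_pow_four_mul (E1.mul hd).isBigO_one
  have F2 := (E2.mul hd2).thetaNome_mul.thetaNome_mul
  exact ⟨_, ((((F0.smul (-1)).add (F1.smul ((m + 24) / 8 : ℂ))).add
    (F2.smul (-((m + 24) * (m + 1)) / 128 : ℂ))).add ((E3.mul hd3).smul c)).congr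
    (by ring) (by ring) (by ring) rfl⟩

/-! ### Counting characteristic vectors and the conclusion. -/

namespace IsNSubEightMulLattice

variable {m : ℕ} {Λ : Submodule ℤ (EuclideanSpace ℝ (Fin (m + 24)))}

/-- The theta series of an `n - 24` lattice without roots is a combination of
`θ₃ⁿ⁻⁸ʳ (θ₂θ₄)⁴ʳ`, `r ≤ 3`; this is the resulting formula for the shadow. -/
theorem exists_shadow_decomposition (h : IsNSubEightMulLattice 3 Λ) (hroot : HasNoRoots Λ)
    {w : EuclideanSpace ℝ (Fin (m + 24))} (hw : IsCharacteristicVector Λ w) {s : Λ → ℕ}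
    (hs : ∀ x : Λ, ‖(x : EuclideanSpace ℝ (Fin (m + 24))) + (1 / 2 : ℝ) • w‖ ^ 2 = m / 4 + s x) :
    ∃ c : ℂ, ∀ τ : ℂ, 1 ≤ τ.im → (thetaSeries s + shadowCombination m c
      (thetaSeries intShadowExponent) (-(thetaSeries intSqExponent ^ 4 *
        (fun τ => thetaSeries intSqExponent (τ + 1)) ^ 4))) τ = 0 := by
  obtain ⟨cL, EL⟩ := h.1.hasThetaExpansion hroot
  have ED : HasThetaExpansion ((fun τ => (thetaFactor τ ^ 1)⁻¹ *
      thetaSeries intSqExponent (-1 / τ + 1)) ^ 4 *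
      (fun τ => thetaSeries intSqExponent (τ + 1)) ^ 4) 0 16 (-128) 448 := by
    obtain ⟨e, he, hfe⟩ := hasThetaExpansion_delta
    refine ⟨e, he, fun τ hτ => ?_⟩
    rw [← hfe τ hτ, Pi.mul_apply, Pi.pow_apply, Pi.pow_apply,
      thetaSeries_intSqExponent_shadow τ (by linarith)]
  obtain ⟨c, hc⟩ := exists_hasThetaExpansion_add_thetaCombination EL hasThetaExpansion_int ED m
  have HF := h.1.isThetaTriple.add (isThetaTriple_int.thetaCombination m c)
  obtain ⟨K, hK⟩ := hasThetaExpansion_shadowCombination m c hasThetaExpansion_deltaShadow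
  have hB := (hasThetaExpansion_thetaSeries (h.summable_shadowExponent hs)).add hK
  refine ⟨c, fun τ hτ => mul_left_cancel₀ (pow_ne_zero m (quarterNome_ne_zero τ)) ?_⟩
  have hval : ∀ τ : ℂ, 0 < τ.im →
      ((fun τ => (thetaFactor τ ^ (m + 24))⁻¹ * thetaSeries (latticeExponent Λ) (-1 / τ + 1)) +
      thetaCombination m c (fun τ => (thetaFactor τ ^ 1)⁻¹ *
        thetaSeries intSqExponent (-1 / τ + 1)) (-(thetaSeries intSqExponent ^ 4 *
        (fun τ => thetaSeries intSqExponent (τ + 1)) ^ 4))) τ =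
      quarterNome τ ^ m * (thetaSeries s + shadowCombination m c
      (thetaSeries intShadowExponent) (-(thetaSeries intSqExponent ^ 4 *
        (fun τ => thetaSeries intSqExponent (τ + 1)) ^ 4))) τ := fun τ hτ => by
    rw [Pi.add_apply, Pi.add_apply, mul_add, ← h.thetaSeries_shadow hw hs τ hτ,
      thetaCombination_apply_eq m c (thetaSeries_intSqExponent_shadow τ hτ)]
  rw [mul_zero, ← hval τ (by linarith)]
  -- Cancellation through q³ gives the decay of the first component; the shadow is q^(m/4) times a
  -- bounded function.
  refine HF.shadow_eq_zero m ?_ ?_ (by linarith)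
  · obtain ⟨e, he, hfe⟩ := hc
    obtain ⟨C, hC⟩ := he.bound
    rw [cuspFilter, Filter.eventually_principal] at hC
    refine ⟨C, fun τ hτ => ?_⟩
    have h1 := hC τ hτ
    rw [Pi.one_apply, norm_one, mul_one] at h1
    rw [hfe τ hτ, show (0 : ℂ) + 0 * thetaNome τ + 0 * thetaNome τ ^ 2 + 0 * thetaNome τ ^ 3 +
      thetaNome τ ^ 4 * e τ = e τ * thetaNome τ ^ 4 by ring, norm_mul, norm_pow, norm_thetaNome,
      ← Real.exp_nat_mul]
    refine (mul_le_mul_of_nonneg_right h1 (Real.exp_pos _).le).trans_eq ?_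
    congr 2
    push_cast
    ring
  · obtain ⟨C, hC⟩ := hB.isBigO_one.bound
    rw [cuspFilter, Filter.eventually_principal] at hC
    refine ⟨C, fun τ hτ => ?_⟩
    have h1 := hC τ hτ
    rw [Pi.one_apply, norm_one, mul_one] at h1
    rw [hval τ (by linarith), mul_comm, norm_mul, norm_pow, norm_quarterNome, ← Real.exp_nat_mul]
    refine (mul_le_mul_of_nonneg_right h1 (Real.exp_pos _).le).trans_eq ?_
    congr 2
    ring

/-- The number of characteristic vectors of norm `n - 16`, in terms of that of norm `n - 24`. -/
theorem ncard_shadowExponent_eq_two (h : IsNSubEightMulLattice 3 Λ) (hroot : HasNoRoots Λ)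
    {w : EuclideanSpace ℝ (Fin (m + 24))} (hw : IsCharacteristicVector Λ w) {s : Λ → ℕ}
    (hs : ∀ x : Λ, ‖(x : EuclideanSpace ℝ (Fin (m + 24))) + (1 / 2 : ℝ) • w‖ ^ 2 = m / 4 + s x) :
    ({x | s x = 2}.ncard : ℤ) =
      2 ^ (m + 1) * (m + 24) * (m + 1) + (m - 48) * {x | s x = 0}.ncard := by
  obtain ⟨c, hc⟩ := h.exists_shadow_decomposition hroot hw hs
  obtain ⟨K, hK⟩ := hasThetaExpansion_shadowCombination m c hasThetaExpansion_deltaShadow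
  obtain ⟨h0, -, h2⟩ := ((hasThetaExpansion_thetaSeries (h.summable_shadowExponent hs)).add
    hK).coeff_eq_zero hc
  have : (({x | s x = 2}.ncard : ℤ) : ℂ) = ((2 ^ (m + 1) * (m + 24) * (m + 1) +
      (m - 48) * {x | s x = 0}.ncard : ℤ) : ℂ) := by
    push_cast
    -- The constant term says c · 2^m = N₀, which eliminates `c`.
    linear_combination h2 - (m - 48 : ℂ) * h0
  exact_mod_cast this

/-- For m ≥ 48 the term in N₀ is nonnegative and can be dropped; 2^23 is the quotient of 2^(m+24) by
2^(m+1). -/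
theorem dim_mul_le (h : IsNSubEightMulLattice 3 Λ) (hroot : HasNoRoots Λ) (hm : 48 ≤ m) :
    (m + 24) * (m + 1) ≤ 2 ^ 23 := by
  obtain ⟨w, hw⟩ := h.1.exists_isCharacteristicVector
  obtain ⟨s, hs⟩ := h.exists_shadowExponent hw
  have h1 := h.ncard_shadowExponent_eq_two hroot hw hs
  have h2 := h.ncard_shadowExponent_eq_two_le hroot hw hs
  have h3 : (0 : ℤ) ≤ (m - 48) * {x | s x = 0}.ncard :=
    mul_nonneg (by omega) (Int.natCast_nonneg _)
  have h4 : (2 : ℤ) ^ (m + 1) * ((m + 24) * (m + 1)) ≤ 2 ^ (m + 1) * 2 ^ 23 := by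
    rw [← pow_add]
    have : ({x | s x = 2}.ncard : ℤ) ≤ 2 ^ (m + 24) := by exact_mod_cast h2
    linarith
  exact_mod_cast le_of_mul_le_mul_left h4 (by positivity)

end IsNSubEightMulLattice

/-- The proof does not use `hBS`: the lower bound for the number of characteristic vectors of norm
`n - 16` that it gives already follows from the nonnegativity of the number of those of norm
`n - 24`. -/
theorem mainTheorem6 (hBS : BelfioreSoleConjecture) (n : ℕ) (hn : 23171 ≤ n) (hn' : n ≤ 8388630) :
    ¬ ∃ Λ : Submodule ℤ (EuclideanSpace ℝ (Fin n)), IsNSubEightMulLattice 3 Λ ∧ HasNoRoots Λ := by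
  rintro ⟨Λ, h, hroot⟩
  obtain ⟨m, rfl⟩ := Nat.exists_eq_add_of_le' (show 24 ≤ n by omega)
  nlinarith [h.dim_mul_le hroot (by omega)]
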